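/- Work over $\mathbb{C}$, let $n\ge 1$, and let $\mathbb{G}_a^n=(\mathbb{C}^n,+)$. An \emph{additive action} on $\mathbb{P}^n$ is an effective algebraic action $\alpha:\mathbb{G}_a^n\times\mathbb{P}^n\to\mathbb{P}^n$ that has a Zariski open orbit $O$. It satisfies the \emph{OP-condition} if for every $\mathbb{G}_a^n$-orbit $O'$ in $\mathbb{P}^n$ there are a point $x\in O$ and a one-dimensional algebraic subgroup $H\subseteq\mathbb{G}_a^n$ such that the Zariski closure of the orbit $Hx$ intersects $O'$. Two additive actions $\alpha,\beta$ on $\mathbb{P}^n$ are \emph{equivalent} if there are an automorphism $\varphi$ of the algebraic group $\mathbb{G}_a^n$ and an automorphism $\psi$ of the variety $\mathbb{P}^n$ such that $\psi(\alpha(s,x))=\beta(\varphi(s),\psi(x))$ for all $s,x$. If $A$ is a local commutative associative unital $\mathbb{C}$-algebra of dimension $n+1$ with maximal ideal $\mathfrak{m}$, an action $\alpha$ \emph{corresponds to} $A$ if it is equivalent to the action $m\circ[a]=[\exp(m)a]$ of the additive group $\mathfrak{m}\cong\mathbb{G}_a^n$ on $\mathbb{P}(A)\cong\mathbb{P}^n$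 (linear identifications). Proposition. Let $\alpha$ be an additive action of $\mathbb{G}_a^n$ on $\mathbb{P}^n$ that satisfies the OP-condition. Then: (a) $\alpha$ is equivalent to the action $$(s_1,\ldots,s_n)\circ[z_0:z_1:\ldots:z_n]=[z_0:z_1+s_1z_0:\ldots:z_n+s_nz_0];$$ (b) there is a local algebra $A$ of dimension $n+1$ to which $\alpha$ corresponds and whose maximal ideal $\mathfrak{m}$ satisfies $\mathfrak{m}^2=0$; and $\mathfrak{m}^2=0$ holds for the maximal ideal $\mathfrak{m}$ of every local algebra of dimension $n+1$ to which $\alpha$ corresponds. Conversely, the action in (a) is an additive action on $\mathbb{P}^n$ and it satisfies the OP-condition. -/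

import Mathlib

open scoped Topology

universe u

noncomputable section

namespace AdditiveActions

/-- The (closed points of the) affine space `𝔸ⁿ` over `ℂ`; with its vector addition it is the
algebraic group `𝔾ₐⁿ`. -/
abbrev Ga (n : ℕ) : Type := Fin n → ℂ

/-- The (closed points of the) projective space `ℙⁿ` over `ℂ`. -/
abbrev Proj (n : ℕ) : Type := Projectivization ℂ (Fin (n + 1) → ℂ)

/-! ### Zariski topology and regular maps -/

/-- The principal open subset `{f ≠ 0}` of `ℙⁿ` (used for homogeneous `f`, where the choice of the
representative is irrelevant). -/
def basicOpen {n : ℕ} (f : MvPolynomial (Fin (n + 1)) ℂ) : Set (Proj n) :=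
  {p | MvPolynomial.eval p.rep f ≠ 0}

/-- The Zariski topology of `ℙⁿ`: the sets `{f ≠ 0}` with `f` homogeneous form a basis. -/
abbrev zariski (n : ℕ) : TopologicalSpace (Proj n) :=
  TopologicalSpace.generateFrom
    {U | ∃ (f : MvPolynomial (Fin (n + 1)) ℂ) (d : ℕ), f.IsHomogeneous d ∧ U = basicOpen f}

/-- Morphisms of affine spaces: maps given by polynomials. -/
def IsPolynomialMap {k m : ℕ} (f : (Fin k → ℂ) → (Fin m → ℂ)) : Prop :=
  ∃ F : Fin m → MvPolynomial (Fin k) ℂ, ∀ s j, f s j = MvPolynomial.eval s (F j)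

/-- Morphisms `ℙⁿ → ℙᵐ`: near each point, the map is given by forms of a common degree that do not
vanish simultaneously at that point. (Multiplying the forms by a form that cuts out a smaller
neighbourhood, one may ask for the formula wherever the forms do not all vanish.) -/
def IsRegularMap {n m : ℕ} (f : Proj n → Proj m) : Prop :=
  ∀ z₀ : Fin (n + 1) → ℂ, z₀ ≠ 0 →
    ∃ (d : ℕ) (F : Fin (m + 1) → MvPolynomial (Fin (n + 1)) ℂ),
      (∀ j, (F j).IsHomogeneous d) ∧
      (fun j => MvPolynomial.eval z₀ (F j)) ≠ 0 ∧
      ∀ (z : Fin (n + 1) → ℂ) (hz : z ≠ 0) (hF : (fun j => MvPolynomial.eval z (F j)) ≠ 0),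
        f (Projectivization.mk ℂ z hz) = Projectivization.mk ℂ _ hF

/-- The value at `(s, z)` of a polynomial in `z` whose coefficients are polynomials in `s`. -/
def evalPair {k n : ℕ} (s : Fin k → ℂ) (z : Fin (n + 1) → ℂ)
    (F : MvPolynomial (Fin (n + 1)) (MvPolynomial (Fin k) ℂ)) : ℂ :=
  MvPolynomial.eval z (MvPolynomial.map (MvPolynomial.eval s) F)

/-- Morphisms `𝔸ᵏ × ℙⁿ → ℙᵐ`: near each point, the map is given by polynomials in `(s, z)` that are
homogeneous in `z` of a common degree and do not vanish simultaneously at that point. -/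
def IsRegularFamily {k n m : ℕ} (f : (Fin k → ℂ) → Proj n → Proj m) : Prop :=
  ∀ (s₀ : Fin k → ℂ) (z₀ : Fin (n + 1) → ℂ), z₀ ≠ 0 →
    ∃ (d : ℕ) (F : Fin (m + 1) → MvPolynomial (Fin (n + 1)) (MvPolynomial (Fin k) ℂ)),
      (∀ j, (F j).IsHomogeneous d) ∧
      (fun j => evalPair s₀ z₀ (F j)) ≠ 0 ∧
      ∀ (s : Fin k → ℂ) (z : Fin (n + 1) → ℂ) (hz : z ≠ 0)
        (hF : (fun j => evalPair s z (F j)) ≠ 0),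
        f s (Projectivization.mk ℂ z hz) = Projectivization.mk ℂ _ hF

/-! ### Additive actions, equivalence, the OP-condition -/

/-- The orbit of a point. -/
def orbit {n : ℕ} (α : Ga n → Proj n → Proj n) (x : Proj n) : Set (Proj n) :=
  Set.range fun s => α s x

/-- An additive action on `ℙⁿ`: an effective algebraic action of `𝔾ₐⁿ` with a Zariski open
orbit. -/
structure IsAdditiveAction {n : ℕ} (α : Ga n → Proj n → Proj n) : Prop where
  zero_act : ∀ x, α 0 x = x
  add_act : ∀ s t x, α (s + t) x = α s (α t x)
  regular : IsRegularFamily α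
  effective : ∀ s, (∀ x, α s x = x) → s = 0
  open_orbit : ∃ x, IsOpen[zariski n] (orbit α x)

/-- Two actions of `𝔾ₐⁿ` on `ℙⁿ` are equivalent if some automorphism `ψ` of the variety `ℙⁿ`
carries one to the other, up to an automorphism `φ` of the algebraic group `𝔾ₐⁿ`. -/
def Equivalent {n : ℕ} (α β : Ga n → Proj n → Proj n) : Prop :=
  ∃ (φ : Ga n ≃+ Ga n) (ψ : Proj n ≃ Proj n),
    IsPolynomialMap φ ∧ IsPolynomialMap φ.symm ∧ IsRegularMap ψ ∧ IsRegularMap ψ.symm ∧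
    ∀ s x, ψ (α s x) = β (φ s) (ψ x)

/-- `H` is a one-dimensional algebraic subgroup of `𝔾ₐⁿ`: it is Zariski closed, and its coordinate
ring has Krull dimension one. -/
def IsOneDimAlgebraicSubgroup {n : ℕ} (H : AddSubgroup (Ga n)) : Prop :=
  MvPolynomial.zeroLocus ℂ (MvPolynomial.vanishingIdeal ℂ (H : Set (Fin n → ℂ))) =
      (H : Set (Fin n → ℂ)) ∧
    ringKrullDim (MvPolynomial (Fin n) ℂ ⧸
      MvPolynomial.vanishingIdeal ℂ (H : Set (Fin n → ℂ))) = 1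

/-- The OP-condition: for every orbit `O'` (that of `y`) there are a point `x` of the open orbit and
a one-dimensional algebraic subgroup `H` such that the Zariski closure of `H x` meets `O'`. -/
def OPCondition {n : ℕ} (α : Ga n → Proj n → Proj n) : Prop :=
  ∀ y : Proj n, ∃ x : Proj n, IsOpen[zariski n] (orbit α x) ∧
    ∃ H : AddSubgroup (Ga n), IsOneDimAlgebraicSubgroup H ∧
      (closure[zariski n] ((fun s => α s x) '' (H : Set (Ga n))) ∩ orbit α y).Nonempty

/-! ### The translation action -/

/-- `(z₀, z₁, …, zₙ) ↦ (z₀, z₁ + s₁ z₀, …, zₙ + sₙ z₀)`. -/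
def translationLinear {n : ℕ} (s : Ga n) : (Fin (n + 1) → ℂ) →ₗ[ℂ] (Fin (n + 1) → ℂ) where
  toFun z := Fin.cons (z 0) fun i => z i.succ + s i * z 0
  map_add' z w := by
    funext j
    refine Fin.cases ?_ (fun i => ?_) j
    · simp
    · simp only [Pi.add_apply, Fin.cons_succ]; ring
  map_smul' c z := by
    funext j
    refine Fin.cases ?_ (fun i => ?_) j
    · simp
    · simp only [Pi.smul_apply, Fin.cons_succ, smul_eq_mul, RingHom.id_apply]; ring

theorem translationLinear_injective {n : ℕ} (s : Ga n) :
    Function.Injective (translationLinear s) := by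
  intro z w h
  have h0 : z 0 = w 0 := by simpa [translationLinear] using congrFun h 0
  funext j
  refine Fin.cases h0 (fun i => ?_) j
  have hi := congrFun h i.succ
  simpa [translationLinear, h0] using hi

/-- The action `(s₁, …, sₙ) ∘ [z₀ : z₁ : … : zₙ] = [z₀ : z₁ + s₁ z₀ : … : zₙ + sₙ z₀]`. -/
def translationAction (n : ℕ) (s : Ga n) : Proj n → Proj n :=
  Projectivization.map (translationLinear s) (translationLinear_injective s)

/-! ### Actions from local algebras -/

section LocalAlgebra

/-- `exp a = ∑ aⁱ / i!` for a nilpotent element `a` of a `ℂ`-algebra. -/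
def nilpExp {A : Type*} [CommRing A] [Algebra ℂ A] (a : A) : A :=
  ∑ i ∈ Finset.range (nilpotencyClass a), ((i.factorial : ℂ)⁻¹) • a ^ i

variable (A : Type*) [CommRing A] [Algebra ℂ A] [IsLocalRing A] [FiniteDimensional ℂ A]

theorem isNilpotent_of_mem_maximalIdeal (m : IsLocalRing.maximalIdeal A) :
    IsNilpotent (m : A) := by
  have : IsArtinianRing A := IsArtinianRing.of_finite ℂ A
  have h := IsArtinianRing.isNilpotent_jacobson_bot (R := A)
  rw [IsLocalRing.jacobson_eq_maximalIdeal ⊥ bot_ne_top] at h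
  obtain ⟨k, hk⟩ := h
  exact ⟨k, by simpa [hk] using Ideal.pow_mem_pow m.2 k⟩

theorem isUnit_nilpExp (m : IsLocalRing.maximalIdeal A) : IsUnit (nilpExp (m : A)) := by
  obtain ⟨k, hk⟩ : ∃ k, nilpotencyClass (m : A) = k + 1 :=
    Nat.exists_eq_succ_of_ne_zero
      (pos_nilpotencyClass_iff.2 (isNilpotent_of_mem_maximalIdeal A m)).ne'
  have hmem : ∑ i ∈ Finset.range k, (((i + 1).factorial : ℂ)⁻¹) • (m : A) ^ (i + 1) ∈
      IsLocalRing.maximalIdeal A :=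
    Ideal.sum_mem _ fun i _ => Submodule.smul_of_tower_mem _ _
      (Ideal.pow_mem_of_mem _ m.2 _ i.succ_pos)
  have hexp : nilpExp (m : A) =
      1 + ∑ i ∈ Finset.range k, (((i + 1).factorial : ℂ)⁻¹) • (m : A) ^ (i + 1) := by
    rw [nilpExp, hk, Finset.sum_range_succ', add_comm]
    simp
  by_contra hu
  have h1 := (IsLocalRing.mem_maximalIdeal _).2 hu
  rw [hexp] at h1
  exact (Ideal.ne_top_iff_one _).1 (IsLocalRing.maximalIdeal.isMaximal A).ne_top
    ((Ideal.add_mem_iff_left _ hmem).1 h1)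

/-- The action `m ∘ [a] = [exp(m) a]` of the additive group of the maximal ideal on `ℙ(A)`. -/
def localAlgebraAction (m : IsLocalRing.maximalIdeal A) :
    Projectivization ℂ A → Projectivization ℂ A :=
  Projectivization.map (LinearMap.mulLeft ℂ (nilpExp (m : A)))
    (isUnit_nilpExp A m).mul_right_injective

/-- The same action in coordinates: `ε` identifies `𝔾ₐⁿ` with the additive group of the maximal
ideal, and `e` identifies `ℙⁿ` with `ℙ(A)`. -/
def localAlgebraActionInCoordinates {n : ℕ} (ε : Ga n ≃ₗ[ℂ] IsLocalRing.maximalIdeal A)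
    (e : (Fin (n + 1) → ℂ) ≃ₗ[ℂ] A) (s : Ga n) (p : Proj n) : Proj n :=
  Projectivization.map e.symm.toLinearMap e.symm.injective
    (localAlgebraAction A (ε s) (Projectivization.map e.toLinearMap e.injective p))

/-- The action `α` on `ℙⁿ` corresponds to the local algebra `A`: it is equivalent to the action
`m ∘ [a] = [exp(m) a]` (read in linear coordinates, whose choice does not matter). -/
def CorrespondsTo {n : ℕ} (α : Ga n → Proj n → Proj n) : Prop :=
  ∃ (ε : Ga n ≃ₗ[ℂ] IsLocalRing.maximalIdeal A) (e : (Fin (n + 1) → ℂ) ≃ₗ[ℂ] A),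
    Equivalent α (localAlgebraActionInCoordinates A ε e)

end LocalAlgebra

end AdditiveActions

end

/-!
The first half of the argument recovers linear algebra from an abstract additive action `α` on `ℙⁿ`.
A morphism `𝔸ᵏ × ℙⁿ → ℙᵐ` is given locally by tuples of forms in `z` whose coefficients are
polynomials in `s`. The ring of such polynomials is factorial, so a tuple can be divided by its
greatest common divisor, and the reduced tuple divides every other tuple that represents the same
morphism; hence it represents the morphism everywhere (`IsRegularFamily.exists_global`). As `α 0` is
the identity, the forms are linear (`degree_eq_one_of_represents_id`), that is, `α s [z] = [ρ(s) z]`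
with a matrix `ρ(s)` that is polynomial in `s`; after a normalisation `ρ` is a representation
(`IsAdditiveAction.exists_representation`). Along each line `ρ` satisfies the differential equation
of a one-parameter group, so `ρ(s) = exp N(s)` with `N` linear and the `N(s)` nilpotent and pairwise
commuting (`exists_pow_eq_zero_and_eq_sum`). The algebra `A` generated by the `N(s)` is local. A
vector over a point of the open orbit is cyclic, and identifies `A` with `ℂⁿ⁺¹` and `N` with an
isomorphism from `ℂⁿ` to the maximal ideal `𝔪`. This turns `α` into the action of `A`
(`IsAdditiveAction.exists_localAlgebra`).

The second half concerns any local algebra `A` to which an action with the OP-condition corresponds.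
A Zariski closed subgroup of `ℂⁿ` is a linear subspace, so a one-dimensional one is a line, and the
curves of the OP-condition are `t ↦ [exp(t m) a]` with `m ∈ 𝔪` and `a` invertible. If `m ≠ 0`, the
closure of such a curve is a rational normal curve, whose only point on the hyperplane `ℙ(𝔪)` is
`[mᵈ a]`, where `mᵈ` with `d ≥ 1` is the last nonzero power of `m`; this vector has square zero
(`mul_self_eq_zero_of_mem_closure`). The OP-condition says that the orbit of each point `[y]` of
`ℙ(𝔪)` contains such a point, and the orbit consists of multiples of `y` by units, so `y² = 0` for
all `y ∈ 𝔪`. Polarisation gives `𝔪² = 0` (`maximalIdeal_sq_eq_bot_of_opCondition`). In that case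
`exp m = 1 + m`, and in the coordinates `A = ℂ ⊕ 𝔪` the action is by translations
(`equivalent_translationAction_of_sq_eq_bot`).

For the translation action itself the boundary point `[0 : h]` is the limit of `[1 : u h]`, `u → ∞`
(`opCondition_translationAction`).
-/

namespace AdditiveActions

open MvPolynomial

/-! ### Forms and the Zariski topology -/

theorem aeval_eq_eval_apply {k : ℕ} (z : Fin k → ℂ) (F : MvPolynomial (Fin k) ℂ) :
    aeval z F = eval z F := rfl

theorem eval_smul_of_isHomogeneous {k d : ℕ} {f : MvPolynomial (Fin k) ℂ} (hf : f.IsHomogeneous d)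
    (c : ℂ) (z : Fin k → ℂ) : eval (c • z) f = c ^ d * eval z f := by
  rw [eval_eq', eval_eq', Finset.mul_sum]
  refine Finset.sum_congr rfl fun m hm => ?_
  have h : ∑ i, m i = d := by
    have := hf.degree_eq_sum_deg_support hm
    rw [this]
    exact (Finset.sum_subset (Finset.subset_univ _) fun i _ hi => by simpa using hi).symm
  simp only [Pi.smul_apply, smul_eq_mul, mul_pow, Finset.prod_mul_distrib]
  rw [Finset.prod_pow_eq_pow_sum, h]
  ring

theorem mk_mem_basicOpen {n d : ℕ} {f : MvPolynomial (Fin (n + 1)) ℂ} (hf : f.IsHomogeneous d)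
    {z : Fin (n + 1) → ℂ} (hz : z ≠ 0) :
    Projectivization.mk ℂ z hz ∈ basicOpen f ↔ eval z f ≠ 0 := by
  obtain ⟨a, ha⟩ := Projectivization.exists_smul_eq_mk_rep ℂ z hz
  rw [basicOpen, Set.mem_ofPred_eq, ← ha, Units.smul_def, eval_smul_of_isHomogeneous hf]
  simp

theorem basicOpen_mul {n : ℕ} (f g : MvPolynomial (Fin (n + 1)) ℂ) :
    basicOpen (f * g) = basicOpen f ∩ basicOpen g := by
  ext p
  simp [basicOpen]

theorem isOpen_basicOpen {n d : ℕ} {f : MvPolynomial (Fin (n + 1)) ℂ} (hf : f.IsHomogeneous d) :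
    IsOpen[zariski n] (basicOpen f) :=
  TopologicalSpace.isOpen_generateFrom_of_mem ⟨f, d, hf, rfl⟩

theorem exists_basicOpen_subset {n : ℕ} {U : Set (Proj n)} (hU : IsOpen[zariski n] U) {p : Proj n}
    (hp : p ∈ U) : ∃ (f : MvPolynomial (Fin (n + 1)) ℂ) (d : ℕ), f.IsHomogeneous d ∧
      p ∈ basicOpen f ∧ basicOpen f ⊆ U := by
  change TopologicalSpace.GenerateOpen _ U at hU
  induction hU with
  | basic s hs =>
    obtain ⟨f, d, hf, rfl⟩ := hs
    exact ⟨f, d, hf, hp, subset_rfl⟩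
  | univ => exact ⟨1, 0, isHomogeneous_one _ _, by simp [basicOpen], Set.subset_univ _⟩
  | inter s t _ _ ihs iht =>
    obtain ⟨f, d, hf, hpf, hfs⟩ := ihs hp.1
    obtain ⟨g, e, hg, hpg, hgt⟩ := iht hp.2
    refine ⟨f * g, d + e, hf.mul hg, ?_, ?_⟩
    · rw [basicOpen_mul]; exact ⟨hpf, hpg⟩
    · rw [basicOpen_mul]; exact Set.inter_subset_inter hfs hgt
  | sUnion S _ ih =>
    obtain ⟨t, ht, hpt⟩ := hp
    obtain ⟨f, d, hf, hpf, hft⟩ := ih t ht hpt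
    exact ⟨f, d, hf, hpf, hft.trans (Set.subset_sUnion_of_mem ht)⟩

theorem mem_zariski_closure_iff {n : ℕ} {S : Set (Proj n)} {p : Proj n} :
    p ∈ closure[zariski n] S ↔ ∀ (f : MvPolynomial (Fin (n + 1)) ℂ) (d : ℕ), f.IsHomogeneous d →
      p ∈ basicOpen f → (basicOpen f ∩ S).Nonempty := by
  let := zariski n
  rw [mem_closure_iff]
  constructor
  · intro h f d hf hp
    exact h _ (isOpen_basicOpen hf) hp
  · intro h U hU hp
    obtain ⟨f, d, hf, hpf, hfU⟩ := exists_basicOpen_subset hU hp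
    exact (h f d hf hpf).mono (Set.inter_subset_inter_left _ hfU)

theorem IsRegularMap.continuous {n m : ℕ} {f : Proj n → Proj m} (hf : IsRegularMap f) :
    @Continuous _ _ (zariski n) (zariski m) f := by
  let := zariski n
  let := zariski m
  refine continuous_generateFrom_iff.2 ?_
  rintro _ ⟨g, e, hg, rfl⟩
  rw [isOpen_iff_forall_mem_open]
  intro p hp
  induction p using Projectivization.ind with
  | h z₀ hz₀ =>
  obtain ⟨d, F, hFd, hF₀, hF⟩ := hf z₀ hz₀
  have hp' : eval (fun j => eval z₀ (F j)) g ≠ 0 := by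
    rw [Set.mem_preimage, hF z₀ hz₀ hF₀, mk_mem_basicOpen hg] at hp
    exact hp
  obtain ⟨j, hj⟩ := Function.ne_iff.1 hF₀
  have hcomp : ∀ z, eval z (aeval F g) = eval (fun j => eval z (F j)) g := by
    intro z
    rw [← coe_aeval_eq_eval, ← aeval_eq_eval_apply, RingHom.coe_coe,
      ← AlgHom.comp_apply]
    congr 1
    ext i
    simp
  have hG : (F j * aeval F g).IsHomogeneous (d + d * e) := (hFd j).mul (hg.aeval F hFd)
  refine ⟨basicOpen (F j * aeval F g), ?_, isOpen_basicOpen hG, ?_⟩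
  · intro q hq
    induction q using Projectivization.ind with
    | h z hz =>
    rw [mk_mem_basicOpen hG, map_mul, hcomp] at hq
    have hFz : (fun j => eval z (F j)) ≠ 0 := fun h => left_ne_zero_of_mul hq (congrFun h j)
    rw [Set.mem_preimage, hF z hz hFz, mk_mem_basicOpen hg]
    exact right_ne_zero_of_mul hq
  · rw [mk_mem_basicOpen hG, map_mul, hcomp]
    exact mul_ne_zero hj hp'

/-- The form of degree one that a linear form on `ℂᵏ` is. -/
noncomputable def linearFormPoly {k : ℕ} (l : (Fin k → ℂ) →ₗ[ℂ] ℂ) : MvPolynomial (Fin k) ℂ :=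
  ∑ i, C (l (Pi.single i 1)) * X i

theorem eval_linearFormPoly {k : ℕ} (l : (Fin k → ℂ) →ₗ[ℂ] ℂ) (z : Fin k → ℂ) :
    eval z (linearFormPoly l) = l z := by
  conv_rhs => rw [pi_eq_sum_univ' z]
  simp [linearFormPoly, mul_comm]

theorem isHomogeneous_linearFormPoly {k : ℕ} (l : (Fin k → ℂ) →ₗ[ℂ] ℂ) :
    (linearFormPoly l).IsHomogeneous 1 :=
  IsHomogeneous.sum _ _ _ fun _ _ => isHomogeneous_C_mul_X _ _

/-- Two nonempty Zariski open sets meet; in particular a nonempty one lies in no hyperplane. -/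
theorem not_subset_hyperplane {n : ℕ} {U : Set (Proj n)} (hU : IsOpen[zariski n] U)
    (hne : U.Nonempty) (l : (Fin (n + 1) → ℂ) →ₗ[ℂ] ℂ) (hl : l ≠ 0) :
    ∃ (z : Fin (n + 1) → ℂ) (hz : z ≠ 0), Projectivization.mk ℂ z hz ∈ U ∧ l z ≠ 0 := by
  obtain ⟨p, hp⟩ := hne
  obtain ⟨f, d, hf, hpf, hfU⟩ := exists_basicOpen_subset hU hp
  have hf0 : f ≠ 0 := by
    rintro rfl
    simp [basicOpen] at hpf
  have hl0 : linearFormPoly l ≠ 0 := by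
    intro h
    refine hl (LinearMap.ext fun z => ?_)
    rw [← eval_linearFormPoly, h, map_zero, LinearMap.zero_apply]
  have hprod : f * linearFormPoly l * X 0 ≠ 0 := mul_ne_zero (mul_ne_zero hf0 hl0) (X_ne_zero 0)
  obtain ⟨z, hz⟩ : ∃ z, eval z (f * linearFormPoly l * X 0) ≠ 0 := by
    by_contra! h
    exact hprod (MvPolynomial.funext fun z => by rw [h z, map_zero])
  rw [map_mul, map_mul, eval_linearFormPoly, eval_X] at hz
  have hz0 : z ≠ 0 := by
    rintro rfl
    simp at hz
  refine ⟨z, hz0, hfU ?_, right_ne_zero_of_mul (left_ne_zero_of_mul hz)⟩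
  rw [mk_mem_basicOpen hf]
  exact left_ne_zero_of_mul (left_ne_zero_of_mul hz)

/-! ### Restriction of polynomials to lines; algebraic subgroups of `𝔾ₐⁿ` -/

/-- The restriction `u ↦ F(u h)` of a polynomial to the line spanned by `h`. -/
noncomputable def restrictLine {k : ℕ} (h : Fin k → ℂ) : MvPolynomial (Fin k) ℂ →ₐ[ℂ] Polynomial ℂ :=
  aeval fun i => Polynomial.C (h i) * Polynomial.X

theorem eval_restrictLine {k : ℕ} (h : Fin k → ℂ) (F : MvPolynomial (Fin k) ℂ) (u : ℂ) :
    (restrictLine h F).eval u = eval (u • h) F := by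
  rw [← aeval_eq_eval_apply, ← Polynomial.coe_aeval_eq_eval, ← AlgHom.comp_apply]
  congr 1
  ext i
  simp [restrictLine, mul_comm (h i)]

theorem polynomial_eq_of_eval_natCast {p q : Polynomial ℂ}
    (h : ∀ k : ℕ, p.eval (k : ℂ) = q.eval (k : ℂ)) : p = q := by
  refine Polynomial.eq_of_infinite_eval_eq p q
    ((Set.infinite_range_of_injective (Nat.cast_injective (R := ℂ))).mono ?_)
  rintro _ ⟨k, rfl⟩
  exact h k

theorem IsPolynomialMap.map_smul_of_addMonoidHom {k m : ℕ} (φ : (Fin k → ℂ) →+ (Fin m → ℂ))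
    (hφ : IsPolynomialMap φ) (c : ℂ) (s : Fin k → ℂ) : φ (c • s) = c • φ s := by
  obtain ⟨F, hF⟩ := hφ
  funext j
  have : restrictLine s (F j) = Polynomial.C (φ s j) * Polynomial.X := by
    refine polynomial_eq_of_eval_natCast fun k => ?_
    rw [eval_restrictLine, ← hF, Nat.cast_smul_eq_nsmul, map_nsmul]
    simp [mul_comm (k : ℂ)]
  rw [hF, ← eval_restrictLine, this]
  simp [mul_comm c]

theorem smul_mem_of_zeroLocus_eq {n : ℕ} {H : AddSubgroup (Ga n)}
    (hH : zeroLocus ℂ (vanishingIdeal ℂ (H : Set (Fin n → ℂ))) = (H : Set (Fin n → ℂ)))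
    (c : ℂ) {h : Ga n} (hh : h ∈ H) : c • h ∈ H := by
  rw [← SetLike.mem_coe, ← hH, mem_zeroLocus_iff]
  intro F hF
  rw [mem_vanishingIdeal_iff] at hF
  have : restrictLine h F = 0 := by
    refine polynomial_eq_of_eval_natCast fun k => ?_
    rw [eval_restrictLine, Nat.cast_smul_eq_nsmul, ← aeval_eq_eval_apply,
      hF _ (H.nsmul_mem hh k)]
    simp
  rw [aeval_eq_eval_apply, ← eval_restrictLine, this, Polynomial.eval_zero]

/-- The coordinate ring of a linear subspace of `ℂⁿ` is a polynomial ring in as many variables as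
its dimension. -/
theorem ringKrullDim_coordinateRing_submodule {n : ℕ} (W : Submodule ℂ (Fin n → ℂ)) :
    ringKrullDim (MvPolynomial (Fin n) ℂ ⧸ vanishingIdeal ℂ (W : Set (Fin n → ℂ))) =
      Module.finrank ℂ W := by
  set k := Module.finrank ℂ W
  let b : Module.Basis (Fin k) ℂ W := Module.finBasis ℂ W
  let L : (Fin k → ℂ) →ₗ[ℂ] (Fin n → ℂ) := W.subtype ∘ₗ b.equivFun.symm.toLinearMap
  have hLinj : LinearMap.ker L = ⊥ := LinearMap.ker_eq_bot.2
    (W.injective_subtype.comp b.equivFun.symm.injective)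
  obtain ⟨P, hP⟩ := L.exists_leftInverse_of_injective hLinj
  let pull {a c : ℕ} (T : (Fin a → ℂ) →ₗ[ℂ] (Fin c → ℂ)) :
      MvPolynomial (Fin c) ℂ →ₐ[ℂ] MvPolynomial (Fin a) ℂ :=
    aeval fun i => linearFormPoly (LinearMap.proj i ∘ₗ T)
  have hpull : ∀ {a c : ℕ} (T : (Fin a → ℂ) →ₗ[ℂ] (Fin c → ℂ)) (F : MvPolynomial (Fin c) ℂ) t,
      eval t (pull T F) = eval (T t) F := by
    intro a c T F t
    rw [← coe_aeval_eq_eval, ← aeval_eq_eval_apply, RingHom.coe_coe,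
      ← AlgHom.comp_apply]
    congr 1
    ext i
    simp only [pull, AlgHom.comp_apply, aeval_X]
    rw [aeval_eq_eval_apply, eval_linearFormPoly]
    rfl
  have hsurj : Function.Surjective (pull L) := fun F => ⟨pull P F, by
    refine MvPolynomial.funext fun t => ?_
    rw [hpull, hpull, ← LinearMap.comp_apply, hP, LinearMap.id_apply]⟩
  have hker : RingHom.ker (pull L) = vanishingIdeal ℂ (W : Set (Fin n → ℂ)) := by
    ext F
    rw [RingHom.mem_ker, mem_vanishingIdeal_iff]
    constructor
    · intro h w hw
      have := hpull L F (b.equivFun ⟨w, hw⟩)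
      rw [h, map_zero] at this
      rw [aeval_eq_eval_apply, this]
      simp [L]
    · intro h
      refine MvPolynomial.funext fun t => ?_
      rw [hpull, map_zero]
      exact h _ (b.equivFun.symm t).2
  rw [← hker, ringKrullDim_eq_of_ringEquiv
    (Ideal.quotientKerAlgEquivOfSurjective hsurj).toRingEquiv,
    MvPolynomial.ringKrullDim_of_isNoetherianRing]
  simp

theorem exists_eq_span_of_isOneDimAlgebraicSubgroup {n : ℕ} {H : AddSubgroup (Ga n)}
    (hH : IsOneDimAlgebraicSubgroup H) :
    ∃ h : Ga n, ∀ s ∈ H, ∃ c : ℂ, c • h = s := by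
  let W : Submodule ℂ (Fin n → ℂ) :=
    { H with smul_mem' := fun c _ hh => smul_mem_of_zeroLocus_eq hH.1 c hh }
  have h1 : Module.finrank ℂ W = 1 := by
    have := ringKrullDim_coordinateRing_submodule W
    have h2 := hH.2
    change ringKrullDim (MvPolynomial (Fin n) ℂ ⧸ vanishingIdeal ℂ (W : Set (Fin n → ℂ))) = 1 at h2
    rw [h2] at this
    exact_mod_cast this.symm
  obtain ⟨v, -, hv⟩ := finrank_eq_one_iff'.1 h1
  refine ⟨v, fun s hs => ?_⟩
  obtain ⟨c, hc⟩ := hv ⟨s, hs⟩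
  exact ⟨c, congrArg Subtype.val hc⟩

theorem isOneDimAlgebraicSubgroup_span {n : ℕ} {h : Ga n} (hh : h ≠ 0) :
    IsOneDimAlgebraicSubgroup (Submodule.span ℂ {h}).toAddSubgroup := by
  refine ⟨subset_antisymm (fun s hs => ?_) (zeroLocus_vanishingIdeal_le _), ?_⟩
  · by_contra hns
    obtain ⟨l, hl, hlW⟩ := Submodule.exists_le_ker_of_notMem hns
    refine hl ?_
    rw [mem_zeroLocus_iff] at hs
    have := hs (linearFormPoly l) (by
      rw [mem_vanishingIdeal_iff]
      intro w hw
      rw [aeval_eq_eval_apply, eval_linearFormPoly]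
      exact hlW hw)
    rwa [aeval_eq_eval_apply, eval_linearFormPoly] at this
  · have := ringKrullDim_coordinateRing_submodule (Submodule.span ℂ {h})
    rw [finrank_span_singleton hh] at this
    exact_mod_cast this

/-! ### The translation action -/

theorem mk_congr {n : ℕ} {v w : Fin (n + 1) → ℂ} (h : v = w) (hv : v ≠ 0) (hw : w ≠ 0) :
    Projectivization.mk ℂ v hv = Projectivization.mk ℂ w hw := by
  subst h; rfl

theorem translationLinear_apply_zero {n : ℕ} (s : Ga n) (z : Fin (n + 1) → ℂ) :
    translationLinear s z 0 = z 0 := rfl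

theorem translationLinear_apply_succ {n : ℕ} (s : Ga n) (z : Fin (n + 1) → ℂ) (i : Fin n) :
    translationLinear s z i.succ = z i.succ + s i * z 0 := rfl

theorem translationLinear_ne_zero {n : ℕ} (s : Ga n) {z : Fin (n + 1) → ℂ} (hz : z ≠ 0) :
    translationLinear s z ≠ 0 :=
  fun h => hz (translationLinear_injective s (h.trans (map_zero _).symm))

theorem translationAction_mk {n : ℕ} (s : Ga n) {z : Fin (n + 1) → ℂ} (hz : z ≠ 0) :
    translationAction n s (Projectivization.mk ℂ z hz) =
      Projectivization.mk ℂ (translationLinear s z) (translationLinear_ne_zero s hz) := rfl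

theorem single_zero_ne_zero (n : ℕ) : (Pi.single 0 1 : Fin (n + 1) → ℂ) ≠ 0 := by
  simp

/-- The point `[1 : 0 : … : 0]`, whose orbit under translations is the affine chart `z₀ ≠ 0`. -/
noncomputable def basePoint (n : ℕ) : Proj n :=
  Projectivization.mk ℂ (Pi.single 0 1) (single_zero_ne_zero n)

theorem orbit_basePoint (n : ℕ) :
    orbit (translationAction n) (basePoint n) = basicOpen (X 0) := by
  ext p
  induction p using Projectivization.ind with
  | h z hz =>
  rw [mk_mem_basicOpen (isHomogeneous_X ℂ 0), eval_X]
  constructor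
  · rintro ⟨s, hs⟩
    change translationAction n s (Projectivization.mk ℂ _ _) = _ at hs
    rw [translationAction_mk, Projectivization.mk_eq_mk_iff'] at hs
    obtain ⟨a, ha⟩ := hs
    intro h0
    have := congrFun ha 0
    rw [Pi.smul_apply, h0, translationLinear_apply_zero] at this
    simp at this
  · intro h0
    refine ⟨fun i => z i.succ / z 0, ?_⟩
    change translationAction n _ (Projectivization.mk ℂ _ _) = _
    rw [translationAction_mk, Projectivization.mk_eq_mk_iff']
    refine ⟨(z 0)⁻¹, funext fun j => ?_⟩
    refine Fin.cases ?_ (fun i => ?_) j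
    · rw [translationLinear_apply_zero]; simp [h0]
    · rw [translationLinear_apply_succ]; simp [div_eq_inv_mul]

theorem isOpen_orbit_basePoint (n : ℕ) :
    IsOpen[zariski n] (orbit (translationAction n) (basePoint n)) := by
  rw [orbit_basePoint]
  exact isOpen_basicOpen (isHomogeneous_X ℂ 0)

theorem isRegularFamily_translationAction (n : ℕ) : IsRegularFamily (translationAction n) := by
  intro s₀ z₀ hz₀
  let F : Fin (n + 1) → MvPolynomial (Fin (n + 1)) (MvPolynomial (Fin n) ℂ) :=
    Fin.cons (X 0) fun i => X i.succ + C (X i) * X 0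
  have hF : ∀ (s : Ga n) (z : Fin (n + 1) → ℂ),
      (fun j => evalPair s z (F j)) = translationLinear s z := by
    intro s z
    funext j
    refine Fin.cases ?_ (fun i => ?_) j
    · simp [F, evalPair, translationLinear_apply_zero]
    · simp [F, evalPair, translationLinear_apply_succ]
  refine ⟨1, F, fun j => ?_, ?_, fun s z hz hFz => ?_⟩
  · refine Fin.cases (isHomogeneous_X _ _) (fun i => ?_) j
    exact (isHomogeneous_X _ _).add (isHomogeneous_C_mul_X _ _)
  · rw [hF]
    exact translationLinear_ne_zero _ hz₀
  · rw [translationAction_mk]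
    exact mk_congr (hF s z).symm _ _

theorem isAdditiveAction_translationAction (n : ℕ) : IsAdditiveAction (translationAction n) where
  zero_act p := by
    induction p using Projectivization.ind with
    | h z hz =>
    rw [translationAction_mk]
    refine mk_congr (funext fun j => ?_) _ _
    refine Fin.cases rfl (fun i => ?_) j
    simp [translationLinear_apply_succ]
  add_act s t p := by
    induction p using Projectivization.ind with
    | h z hz =>
    rw [translationAction_mk, translationAction_mk, translationAction_mk]
    refine mk_congr (funext fun j => ?_) _ _
    refine Fin.cases rfl (fun i => ?_) j
    simp only [translationLinear_apply_succ, translationLinear_apply_zero, Pi.add_apply]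
    ring
  regular := isRegularFamily_translationAction n
  effective s hs := by
    have h := hs (basePoint n)
    change translationAction n _ (Projectivization.mk ℂ _ _) = Projectivization.mk ℂ _ _ at h
    rw [translationAction_mk, Projectivization.mk_eq_mk_iff'] at h
    obtain ⟨a, ha⟩ := h
    funext i
    have := congrFun ha i.succ
    rw [translationLinear_apply_succ] at this
    simpa using this.symm
  open_orbit := ⟨_, isOpen_orbit_basePoint n⟩

/-- A point `[0 : h]` of the boundary is the limit of `[1 : u h]` for `u → ∞`. -/
theorem opCondition_translationAction {n : ℕ} (hn : 1 ≤ n) :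
    OPCondition (translationAction n) := by
  intro p
  induction p using Projectivization.ind with
  | h z hz =>
  by_cases h0 : z 0 = 0
  · have hh : (fun i : Fin n => z i.succ) ≠ 0 := by
      intro h
      refine hz (funext fun j => ?_)
      exact Fin.cases h0 (fun i => congrFun h i) j
    refine ⟨_, isOpen_orbit_basePoint n, _, isOneDimAlgebraicSubgroup_span hh,
      Projectivization.mk ℂ z hz, ?_, ⟨0, (isAdditiveAction_translationAction n).zero_act _⟩⟩
    rw [mem_zariski_closure_iff]
    intro f d hf hp
    rw [mk_mem_basicOpen hf] at hp
    -- the form does not vanish at `(ε, h)` for small `ε ≠ 0`, a representative of `[1 : ε⁻¹ h]`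
    have hcont : Continuous fun ε : ℂ => eval (z + ε • Pi.single 0 1) f := by
      have := MvPolynomial.continuous_eval f
      fun_prop
    have hev : ∀ᶠ ε in 𝓝[≠] (0 : ℂ), eval (z + ε • Pi.single 0 1) f ≠ 0 := by
      refine (hcont.continuousAt.eventually_ne ?_).filter_mono nhdsWithin_le_nhds
      simpa using hp
    obtain ⟨ε, hε, hε0⟩ := (hev.and self_mem_nhdsWithin).exists
    have hε0 : ε ≠ 0 := hε0
    have hs : ε⁻¹ • (fun i : Fin n => z i.succ) ∈
        (Submodule.span ℂ {fun i : Fin n => z i.succ}).toAddSubgroup :=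
      Submodule.mem_span_singleton.2 ⟨ε⁻¹, rfl⟩
    refine ⟨_, ?_, _, hs, rfl⟩
    change translationAction n _ (Projectivization.mk ℂ _ _) ∈ _
    rw [translationAction_mk, mk_mem_basicOpen hf]
    have : z + ε • Pi.single 0 1 =
        ε • translationLinear (ε⁻¹ • fun i : Fin n => z i.succ) (Pi.single 0 1) := by
      funext j
      refine Fin.cases ?_ (fun i => ?_) j
      · simp [translationLinear_apply_zero, h0]
      · simp [translationLinear_apply_succ, hε0]
    rw [this, eval_smul_of_isHomogeneous hf] at hε
    exact right_ne_zero_of_mul hε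
  · have hp : Projectivization.mk ℂ z hz ∈ orbit (translationAction n) (basePoint n) := by
      rw [orbit_basePoint, mk_mem_basicOpen (isHomogeneous_X ℂ 0), eval_X]
      exact h0
    obtain ⟨s, hs⟩ := hp
    have hh : (Pi.single ⟨0, hn⟩ 1 : Ga n) ≠ 0 := by simp
    refine ⟨_, isOpen_orbit_basePoint n, _, isOneDimAlgebraicSubgroup_span hh, basePoint n,
      ?_, ⟨-s, ?_⟩⟩
    · let := zariski n
      exact subset_closure ⟨0, zero_mem _, (isAdditiveAction_translationAction n).zero_act _⟩
    · change translationAction n (-s) _ = _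
      rw [← hs]
      change translationAction n (-s) (translationAction n s _) = _
      rw [← (isAdditiveAction_translationAction n).add_act, neg_add_cancel,
        (isAdditiveAction_translationAction n).zero_act]

/-! ### Actions on projective space lift to linear maps -/

/-- The substitution `Xᵢ ↦ T Xᵢ`, under which a form of degree `d` is multiplied by `T ^ d`. -/
noncomputable def scaleVars (σ R : Type*) [CommRing R] :
    MvPolynomial σ R →ₐ[R] Polynomial (MvPolynomial σ R) :=
  aeval fun i => Polynomial.C (X i) * Polynomial.X

theorem scaleVars_monomial {σ R : Type*} [CommRing R] (m : σ →₀ ℕ) (r : R) :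
    scaleVars σ R (monomial m r) = Polynomial.C (monomial m r) * Polynomial.X ^ m.degree := by
  rw [scaleVars, aeval_monomial, monomial_eq, map_mul, Finsupp.prod, Finsupp.prod, map_prod]
  simp only [mul_pow, Finset.prod_mul_distrib, Finset.prod_pow_eq_pow_sum, map_pow]
  rw [← mul_assoc]
  rfl

theorem coeff_scaleVars {σ R : Type*} [CommRing R] (f : MvPolynomial σ R) (k : ℕ) :
    (scaleVars σ R f).coeff k = homogeneousComponent k f := by
  induction f using MvPolynomial.induction_on' with
  | monomial m r =>
    rw [scaleVars_monomial, Polynomial.coeff_C_mul, Polynomial.coeff_X_pow]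
    by_cases h : k = m.degree
    · subst h
      rw [if_pos rfl, mul_one, homogeneousComponent_eq_self (isHomogeneous_monomial r rfl)]
    · rw [if_neg h, mul_zero, homogeneousComponent_of_mem (isHomogeneous_monomial r rfl), if_neg h]
  | add p q hp hq => rw [map_add, Polynomial.coeff_add, hp, hq, map_add]

theorem scaleVars_eq_of_isHomogeneous {σ R : Type*} [CommRing R] {f : MvPolynomial σ R} {d : ℕ}
    (hf : f.IsHomogeneous d) : scaleVars σ R f = Polynomial.monomial d f := by
  ext1 k
  rw [coeff_scaleVars, Polynomial.coeff_monomial, homogeneousComponent_of_mem hf]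
  simp only [eq_comm]

theorem isHomogeneous_of_scaleVars {σ R : Type*} [CommRing R] {f : MvPolynomial σ R} {d : ℕ}
    (hlow : d ≤ (scaleVars σ R f).natTrailingDegree) (hhigh : (scaleVars σ R f).natDegree ≤ d) :
    f.IsHomogeneous d := by
  rw [← sum_homogeneousComponent f]
  refine IsHomogeneous.sum _ _ _ fun k _ => ?_
  by_cases h : k = d
  · subst h; exact homogeneousComponent_isHomogeneous _ _
  · rw [← coeff_scaleVars]
    rcases lt_or_gt_of_ne h with h | h
    · rw [Polynomial.coeff_eq_zero_of_lt_natTrailingDegree (h.trans_le hlow)]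
      exact isHomogeneous_zero _ _ _
    · rw [Polynomial.coeff_eq_zero_of_natDegree_lt (hhigh.trans_lt h)]
      exact isHomogeneous_zero _ _ _

/-- The factors of a nonzero form over a domain are forms: the highest and the lowest degrees of
the homogeneous components are both additive. -/
theorem exists_isHomogeneous_of_mul {σ R : Type*} [CommRing R] [IsDomain R]
    {f g : MvPolynomial σ R} {d : ℕ} (hfg : (f * g).IsHomogeneous d) (h0 : f * g ≠ 0) :
    ∃ a b, a + b = d ∧ f.IsHomogeneous a ∧ g.IsHomogeneous b := by
  have hS := scaleVars_eq_of_isHomogeneous hfg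
  rw [map_mul] at hS
  have hne : scaleVars σ R f * scaleVars σ R g ≠ 0 := by
    rw [hS]; simpa using h0
  have hd := congrArg Polynomial.natDegree hS
  have ht := congrArg Polynomial.natTrailingDegree hS
  rw [Polynomial.natDegree_mul (left_ne_zero_of_mul hne) (right_ne_zero_of_mul hne),
    Polynomial.natDegree_monomial_eq _ h0] at hd
  rw [Polynomial.natTrailingDegree_mul (left_ne_zero_of_mul hne) (right_ne_zero_of_mul hne),
    Polynomial.natTrailingDegree_monomial h0] at ht
  have h1 := Polynomial.natTrailingDegree_le_natDegree (scaleVars σ R f)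
  have h2 := Polynomial.natTrailingDegree_le_natDegree (scaleVars σ R g)
  exact ⟨_, _, hd, isHomogeneous_of_scaleVars (by omega) le_rfl,
    isHomogeneous_of_scaleVars (by omega) le_rfl⟩

/-- `evalPair` as a ring homomorphism. -/
noncomputable def evalPairHom {k n : ℕ} (s : Fin k → ℂ) (z : Fin (n + 1) → ℂ) :
    MvPolynomial (Fin (n + 1)) (MvPolynomial (Fin k) ℂ) →+* ℂ :=
  (eval z).comp (map (eval s))

theorem evalPair_mul {k n : ℕ} (s : Fin k → ℂ) (z : Fin (n + 1) → ℂ)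
    (F G : MvPolynomial (Fin (n + 1)) (MvPolynomial (Fin k) ℂ)) :
    evalPair s z (F * G) = evalPair s z F * evalPair s z G :=
  map_mul (evalPairHom s z) F G

theorem evalPair_zero {k n : ℕ} (s : Fin k → ℂ) (z : Fin (n + 1) → ℂ) :
    evalPair s z (0 : MvPolynomial (Fin (n + 1)) (MvPolynomial (Fin k) ℂ)) = 0 :=
  map_zero (evalPairHom s z)

theorem eq_of_evalPair_eq {k n : ℕ} {F G : MvPolynomial (Fin (n + 1)) (MvPolynomial (Fin k) ℂ)}
    (h : ∀ s z, z ≠ 0 → evalPair s z F = evalPair s z G) : F = G := by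
  -- multiplication by `X₀` makes the two sides agree at `z = 0` as well
  refine mul_right_cancel₀ (X_ne_zero 0) (?_ : F * X 0 = G * X 0)
  have hmap : ∀ s : Fin k → ℂ, map (eval s) (F * X 0) = map (eval s) (G * X 0) := by
    intro s
    refine MvPolynomial.funext fun z => ?_
    change evalPair s z (F * X 0) = evalPair s z (G * X 0)
    rw [evalPair_mul, evalPair_mul]
    by_cases hz : z = 0
    · subst hz; simp [evalPair]
    · rw [h s z hz]
  refine MvPolynomial.ext _ _ fun m => MvPolynomial.funext fun s => ?_
  rw [← coeff_map, hmap, coeff_map]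

/-- In a factorial ring every tuple proportional to `F` is a multiple of `F` divided by its greatest
common divisor. -/
theorem exists_reduced_tuple {ι S : Type*} [Finite ι] [CommRing S] [IsDomain S]
    [UniqueFactorizationMonoid S] (F : ι → S) (hF : F ≠ 0) :
    ∃ (g : S) (F' : ι → S), g ≠ 0 ∧ (∀ j, F j = g * F' j) ∧
      ∀ G : ι → S, (∀ i j, F i * G j = F j * G i) → ∃ h, ∀ j, G j = h * F' j := by
  classical
  cases nonempty_fintype ι
  let : StrongNormalizationMonoid S := UniqueFactorizationMonoid.strongNormalizationMonoid
  let : NormalizedGCDMonoid S := UniqueFactorizationMonoid.toNormalizedGCDMonoid S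
  obtain ⟨i₀, hi₀⟩ := Function.ne_iff.1 hF
  obtain ⟨F', hF', hgcd⟩ := Finset.univ.extract_gcd F ⟨i₀, Finset.mem_univ _⟩
  have hF'j : ∀ j, F j = Finset.univ.gcd F * F' j := fun j => hF' j (Finset.mem_univ _)
  have hg : Finset.univ.gcd F ≠ 0 := by
    intro h
    refine hi₀ ?_
    rw [hF'j, h, zero_mul, Pi.zero_apply]
  have hF'0 : F' i₀ ≠ 0 := by
    intro h
    refine hi₀ ?_
    rw [hF'j, h, mul_zero, Pi.zero_apply]
  refine ⟨_, F', hg, hF'j, fun G hG => ?_⟩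
  have hG' : ∀ i j, F' i * G j = F' j * G i := by
    intro i j
    refine mul_left_cancel₀ hg ?_
    rw [← mul_assoc, ← mul_assoc, ← hF'j, ← hF'j, hG]
  have hdvd : F' i₀ ∣ G i₀ := by
    have h1 : F' i₀ ∣ Finset.univ.gcd fun j => G i₀ * F' j :=
      Finset.dvd_gcd fun j _ => ⟨G j, by rw [mul_comm, ← hG']⟩
    have h2 := (Finset.gcd_mul_left' Finset.univ F' (G i₀)).dvd
    rw [hgcd, mul_one] at h2
    exact h1.trans h2
  obtain ⟨h, hh⟩ := hdvd
  refine ⟨h, fun j => mul_left_cancel₀ hF'0 ?_⟩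
  rw [hG', hh]
  ring

/-- A morphism `𝔸ᵏ × ℙⁿ → ℙᵐ` is given by one and the same tuple of forms everywhere: divide a
tuple that represents it somewhere by the greatest common divisor. -/
theorem IsRegularFamily.exists_global {k n m : ℕ} {f : (Fin k → ℂ) → Proj n → Proj m}
    (hf : IsRegularFamily f) :
    ∃ (d : ℕ) (F : Fin (m + 1) → MvPolynomial (Fin (n + 1)) (MvPolynomial (Fin k) ℂ)),
      (∀ j, (F j).IsHomogeneous d) ∧
      ∀ (s : Fin k → ℂ) (z : Fin (n + 1) → ℂ) (hz : z ≠ 0),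
        ∃ hF : (fun j => evalPair s z (F j)) ≠ 0,
          f s (Projectivization.mk ℂ z hz) = Projectivization.mk ℂ _ hF := by
  have he : (Pi.single 0 1 : Fin (n + 1) → ℂ) ≠ 0 := by simp
  obtain ⟨d, F, hFd, hF₀, hF⟩ := hf 0 _ he
  have hFne : F ≠ 0 := by
    rintro rfl
    exact hF₀ (funext fun j => evalPair_zero _ _)
  obtain ⟨g, F', hg, hFg, hmul⟩ := exists_reduced_tuple F hFne
  obtain ⟨i₀, hi₀⟩ := Function.ne_iff.1 hFne
  obtain ⟨a, b, hab, hga, -⟩ := exists_isHomogeneous_of_mul (hFg i₀ ▸ hFd i₀) (hFg i₀ ▸ hi₀)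
  refine ⟨b, F', fun j => ?_, fun s z hz => ?_⟩
  · by_cases hj : F j = 0
    · rw [(mul_eq_zero.1 ((hFg j).symm.trans hj)).resolve_left hg]
      exact isHomogeneous_zero _ _ _
    · obtain ⟨a', b', hab', hga', hb'⟩ :=
        exists_isHomogeneous_of_mul (hFg j ▸ hFd j) (hFg j ▸ hj)
      have : a' = a := hga'.inj_right hga hg
      have : b' = b := by omega
      exact this ▸ hb'
  · obtain ⟨e, G, -, hG₀, hG⟩ := hf s z hz
    have hFG : ∀ i j, F i * G j = F j * G i := by
      intro i j
      refine eq_of_evalPair_eq fun t w hw => ?_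
      rw [evalPair_mul, evalPair_mul]
      -- the minors vanish trivially at the points where one of the two tuples vanishes
      by_cases h1 : (fun j => evalPair t w (F j)) = 0
      · have := congrFun h1 i
        have := congrFun h1 j
        simp_all
      by_cases h2 : (fun j => evalPair t w (G j)) = 0
      · have := congrFun h2 i
        have := congrFun h2 j
        simp_all
      have h := (hF t w hw h1).symm.trans (hG t w hw h2)
      rw [Projectivization.mk_eq_mk_iff'] at h
      obtain ⟨c, hc⟩ := h
      have hi := congrFun hc i
      have hj := congrFun hc j
      simp only [Pi.smul_apply, smul_eq_mul] at hi hj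
      rw [← hi, ← hj]
      ring
    obtain ⟨h, hh⟩ := hmul G hFG
    have hev : (fun j => evalPair s z (G j)) =
        evalPair s z h • fun j => evalPair s z (F' j) := by
      funext j
      rw [hh, evalPair_mul]
      rfl
    have hne : (fun j => evalPair s z (F' j)) ≠ 0 := by
      intro h0
      rw [h0, smul_zero] at hev
      exact hG₀ hev
    refine ⟨hne, ?_⟩
    rw [hG s z hz hG₀, Projectivization.mk_eq_mk_iff']
    exact ⟨_, hev.symm⟩

/-- Forms of degree `d` that represent the identity of `ℙⁿ`, `n ≥ 1`, and have no common zero are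
linear: on the line `(y, 1, 0, …, 0)` they are `(c yᵈ, c yᵈ⁻¹, 0, …, 0)`. -/
theorem degree_eq_one_of_represents_id {n d : ℕ} (hn : 1 ≤ n)
    (F : Fin (n + 1) → MvPolynomial (Fin (n + 1)) ℂ) (hF : ∀ j, (F j).IsHomogeneous d)
    (hid : ∀ z : Fin (n + 1) → ℂ, z ≠ 0 → ∃ c : ℂ, c ≠ 0 ∧ ∀ j, eval z (F j) = c * z j) :
    d = 1 := by
  obtain ⟨n, rfl⟩ := Nat.exists_eq_add_of_le' hn
  let pt (a b : ℂ) : Fin (n + 1 + 1) → ℂ := Fin.cons a (Fin.cons b 0)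
  let line (a b : Polynomial ℂ) : MvPolynomial (Fin (n + 1 + 1)) ℂ →ₐ[ℂ] Polynomial ℂ :=
    aeval (Fin.cons a (Fin.cons b 0) : Fin (n + 1 + 1) → Polynomial ℂ)
  have hline : ∀ a b f y, (line a b f).eval y = eval (pt (a.eval y) (b.eval y)) f := by
    intro a b f y
    rw [← aeval_eq_eval_apply, ← Polynomial.coe_aeval_eq_eval, ← AlgHom.comp_apply]
    congr 1
    ext i
    refine Fin.cases ?_ (fun i => Fin.cases ?_ (fun i => ?_) i) i <;> simp [line, pt]
  have hpt1 : ∀ a b, pt a b 1 = b := fun a b => rfl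
  have hpt0 : ∀ a b, pt a b 0 = a := fun a b => rfl
  have h1 : ∀ x, pt 1 x ≠ 0 := fun x h => one_ne_zero (congrFun h 0)
  have h2 : ∀ y, pt y 1 ≠ 0 := fun y h => one_ne_zero (congrFun h 1)
  -- the first form has no zero on the affine line `(1, x, 0, …, 0)`, so it is constant there
  obtain ⟨c, hc⟩ : ∃ c, line 1 Polynomial.X (F 0) = Polynomial.C c := by
    refine ⟨_, Polynomial.eq_C_of_degree_eq_zero ?_⟩
    by_contra hdeg
    obtain ⟨x, hx⟩ := IsAlgClosed.exists_root _ hdeg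
    rw [Polynomial.IsRoot, hline] at hx
    obtain ⟨c, hc, hcz⟩ := hid _ (h1 x)
    have := hcz 0
    simp only [Polynomial.eval_one, Polynomial.eval_X] at hx
    rw [hx, hpt0, mul_one] at this
    exact hc this.symm
  have hc' : ∀ x, eval (pt 1 x) (F 0) = c := by
    intro x
    have := hline 1 Polynomial.X (F 0) x
    rw [hc] at this
    simpa using this.symm
  set q := line Polynomial.X 1 (F 1)
  have hq0 : q.eval 0 ≠ 0 := by
    obtain ⟨a, ha, haz⟩ := hid _ (h2 0)
    rw [hline, Polynomial.eval_X, Polynomial.eval_one, haz, hpt1, mul_one]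
    exact ha
  have hmul : Polynomial.X * q = Polynomial.C c * Polynomial.X ^ d := by
    refine mul_left_cancel₀ Polynomial.X_ne_zero (polynomial_eq_of_eval_natCast fun k => ?_)
    generalize (k : ℂ) = y
    by_cases hy : y = 0
    · subst hy; simp
    · obtain ⟨a, -, haz⟩ := hid _ (h2 y)
      have hscale : pt y 1 = y • pt 1 y⁻¹ := by
        funext i
        refine Fin.cases ?_ (fun i => Fin.cases ?_ (fun i => ?_) i) i <;> simp [pt, hy]
      have e0 : eval (pt y 1) (F 0) = c * y ^ d := by
        rw [hscale, eval_smul_of_isHomogeneous (hF 0), hc', mul_comm]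
      have e1 : q.eval y = a := by
        rw [hline, Polynomial.eval_X, Polynomial.eval_one, haz, hpt1, mul_one]
      rw [haz, hpt0] at e0
      simp only [Polynomial.eval_mul, Polynomial.eval_X, Polynomial.eval_C, Polynomial.eval_pow]
      rw [e1, ← e0]
      ring
  have hcoeff := congrArg (fun p => Polynomial.coeff p 1) hmul
  simp only [Polynomial.coeff_X_mul, Polynomial.coeff_C_mul, Polynomial.coeff_X_pow] at hcoeff
  by_contra hd
  rw [if_neg (Ne.symm hd), mul_zero, Polynomial.coeff_zero_eq_eval_zero] at hcoeff
  exact hq0 hcoeff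

/-- An additive action on projective space acts by matrices that are polynomial in the group
element. -/
theorem IsAdditiveAction.exists_matrix {n : ℕ} (hn : 1 ≤ n) {α : Ga n → Proj n → Proj n}
    (hα : IsAdditiveAction α) :
    ∃ M : Matrix (Fin (n + 1)) (Fin (n + 1)) (MvPolynomial (Fin n) ℂ),
      ∀ (s : Ga n) (z : Fin (n + 1) → ℂ) (hz : z ≠ 0),
        ∃ h : (M.map (eval s)).mulVec z ≠ 0,
          α s (Projectivization.mk ℂ z hz) = Projectivization.mk ℂ _ h := by
  obtain ⟨d, F, hFd, hF⟩ := hα.regular.exists_global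
  have hd : d = 1 := by
    refine degree_eq_one_of_represents_id hn (fun j => map (eval 0) (F j))
      (fun j => (hFd j).map _) fun z hz => ?_
    obtain ⟨h, hz'⟩ := hF 0 z hz
    rw [hα.zero_act, eq_comm, Projectivization.mk_eq_mk_iff] at hz'
    obtain ⟨c, hc⟩ := hz'
    exact ⟨c, c.ne_zero, fun j => (congrFun hc j).symm⟩
  subst hd
  have hlin : ∀ j, ∃ c : Fin (n + 1) → MvPolynomial (Fin n) ℂ, ∑ i, c i • X i = F j := by
    intro j
    have := (mem_homogeneousSubmodule 1 (F j)).2 (hFd j)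
    rw [homogeneousSubmodule_one_eq_span_X] at this
    exact (Submodule.mem_span_range_iff_exists_fun _).1 this
  choose M hM using hlin
  refine ⟨Matrix.of M, fun s z hz => ?_⟩
  have hev : (fun j => evalPair s z (F j)) = ((Matrix.of M).map (eval s)).mulVec z := by
    funext j
    rw [← hM]
    simp [evalPair, Matrix.mulVec, dotProduct, smul_eq_C_mul]
  have := hF s z hz
  rwa [hev] at this

theorem eval_eq_eval_zero_of_forall_ne_zero {k : ℕ} {F : MvPolynomial (Fin k) ℂ}
    (hF : ∀ s, eval s F ≠ 0) (s : Fin k → ℂ) : eval s F = eval 0 F := by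
  have hdeg : (restrictLine s F).degree = 0 := by
    by_contra hdeg
    obtain ⟨x, hx⟩ := IsAlgClosed.exists_root _ hdeg
    rw [Polynomial.IsRoot, eval_restrictLine] at hx
    exact hF _ hx
  have hC := Polynomial.eq_C_of_degree_eq_zero hdeg
  have h1 := eval_restrictLine s F 1
  have h0 := eval_restrictLine s F 0
  rw [hC, Polynomial.eval_C] at h0 h1
  rw [one_smul] at h1
  rw [zero_smul] at h0
  rw [← h1, ← h0]

theorem exists_eq_smul_one_of_forall_mulVec {n : ℕ} (B : Matrix (Fin n) (Fin n) ℂ)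
    (hB : ∀ z, ∃ c : ℂ, B.mulVec z = c • z) : ∃ a : ℂ, B = a • 1 := by
  obtain ⟨a, ha⟩ := LinearMap.exists_eq_smul_id_of_forall_notLinearIndependent
    (f := Matrix.toLin' B) fun v => by
      obtain ⟨c, hc⟩ := hB v
      rw [Matrix.toLin'_apply, hc, LinearIndependent.pair_iff]
      intro h
      simpa using (h (-c) 1 (by simp)).2
  refine ⟨a, Matrix.toLin'.injective ?_⟩
  rw [ha, map_smul, Matrix.toLin'_one]
  rfl

/-- An additive action on projective space lifts to a polynomial representation of `𝔾ₐⁿ`. The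
matrices found above multiply up to a scalar; it is a root of a fixed number and depends
continuously on the two arguments, hence is constant and can be normalised away. -/
theorem IsAdditiveAction.exists_representation {n : ℕ} (hn : 1 ≤ n) {α : Ga n → Proj n → Proj n}
    (hα : IsAdditiveAction α) :
    ∃ M : Matrix (Fin (n + 1)) (Fin (n + 1)) (MvPolynomial (Fin n) ℂ),
      M.map (eval 0) = 1 ∧
      (∀ s t : Ga n, M.map (eval (s + t)) = M.map (eval s) * M.map (eval t)) ∧
      ∀ (s : Ga n) (z : Fin (n + 1) → ℂ) (hz : z ≠ 0),
        ∃ h : (M.map (eval s)).mulVec z ≠ 0,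
          α s (Projectivization.mk ℂ z hz) = Projectivization.mk ℂ _ h := by
  obtain ⟨M, hM⟩ := hα.exists_matrix hn
  let ρ : Ga n → Matrix (Fin (n + 1)) (Fin (n + 1)) ℂ := fun s => M.map (eval s)
  have hdet : ∀ s, (ρ s).det = eval s M.det := fun s => ((eval s).map_det M).symm
  have hdet0 : ∀ s, (ρ s).det ≠ 0 := by
    intro s h
    obtain ⟨z, hz, hzs⟩ := Matrix.exists_mulVec_eq_zero_iff.2 h
    exact (hM s z hz).1 hzs
  have hdetc : ∀ s, (ρ s).det = (ρ 0).det := by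
    intro s
    rw [hdet, hdet]
    exact eval_eq_eval_zero_of_forall_ne_zero (fun s => hdet s ▸ hdet0 s) s
  set D := (ρ 0).det
  obtain ⟨c, hc⟩ : ∃ c : ℂ, ρ 0 = c • 1 := by
    refine exists_eq_smul_one_of_forall_mulVec _ fun z => ?_
    by_cases hz : z = 0
    · subst hz; exact ⟨0, by simp⟩
    · obtain ⟨h, hz'⟩ := hM 0 z hz
      rw [hα.zero_act, eq_comm, Projectivization.mk_eq_mk_iff'] at hz'
      obtain ⟨c, hc⟩ := hz'
      exact ⟨c, hc.symm⟩
  have hc0 : c ≠ 0 := by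
    rintro rfl
    refine hdet0 0 ?_
    rw [hc, zero_smul, Matrix.det_zero]
  have hb : ∀ s t, ∃ b : ℂ, ρ s * ρ t * (ρ (s + t)).adjugate = b • 1 := by
    intro s t
    refine exists_eq_smul_one_of_forall_mulVec _ fun w => ?_
    -- apply the product to `w = ρ(s + t) z`
    set z := (ρ (s + t))⁻¹.mulVec w
    have hw : (ρ (s + t)).mulVec z = w := by
      rw [Matrix.mulVec_mulVec, Matrix.mul_nonsing_inv _ (hdet0 _).isUnit, Matrix.one_mulVec]
    rw [← hw, Matrix.mulVec_mulVec, mul_assoc, Matrix.adjugate_mul, mul_smul_comm, mul_one,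
      Matrix.smul_mulVec]
    by_cases hz : z = 0
    · rw [hz]; exact ⟨0, by simp⟩
    · obtain ⟨h1, e1⟩ := hM (s + t) z hz
      obtain ⟨h2, e2⟩ := hM t z hz
      obtain ⟨h3, e3⟩ := hM s _ h2
      rw [hα.add_act, e2, e3, Projectivization.mk_eq_mk_iff'] at e1
      obtain ⟨a, ha⟩ := e1
      refine ⟨(ρ (s + t)).det * a, ?_⟩
      rw [← Matrix.mulVec_mulVec]
      change _ • (M.map (eval s)).mulVec ((M.map (eval t)).mulVec z) = _
      rw [← ha, mul_smul]
  choose b hb using hb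
  have hb00 : ∀ s t, b s t = (ρ s * ρ t * (ρ (s + t)).adjugate) 0 0 := by
    intro s t; rw [hb]; simp
  have hρcont : Continuous ρ := by
    refine continuous_pi fun i => continuous_pi fun j => ?_
    exact MvPolynomial.continuous_eval (M i j)
  have hbcont : Continuous fun p : Ga n × Ga n => b p.1 p.2 := by
    simp only [hb00]
    refine Continuous.matrix_elem ?_ 0 0
    fun_prop
  have hbpow : ∀ s t, b s t ^ (n + 1) = D * D * D ^ n := by
    intro s t
    have := congrArg Matrix.det (hb s t)
    rw [Matrix.det_mul, Matrix.det_mul, Matrix.det_adjugate, Matrix.det_smul, Matrix.det_one,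
      hdetc, hdetc, hdetc] at this
    simpa using this.symm
  have hbconst : ∀ s t, b s t = b 0 0 := by
    intro s t
    have hfin : (Set.range fun p : Ga n × Ga n => b p.1 p.2).Finite := by
      refine Set.Finite.subset (Polynomial.nthRoots (n + 1) (D * D * D ^ n)).toFinset.finite_toSet ?_
      rintro _ ⟨p, rfl⟩
      simpa [Polynomial.mem_nthRoots n.succ_pos] using hbpow p.1 p.2
    have hpre := isPreconnected_range hbcont
    by_contra hne
    exact hpre.infinite_of_nontrivial ⟨_, ⟨(s, t), rfl⟩, _, ⟨(0, 0), rfl⟩, hne⟩ hfin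
  have hmul : ∀ s t, ρ s * ρ t = c • ρ (s + t) := by
    have key : ∀ s t, D • (ρ s * ρ t) = b 0 0 • ρ (s + t) := by
      intro s t
      have := congrArg (· * ρ (s + t)) (hb s t)
      simp only [mul_assoc, Matrix.adjugate_mul, hdetc, hbconst s t] at this
      simpa [mul_assoc] using this
    have hbD : b 0 0 = D * c := by
      have h := key 0 0
      rw [add_zero, hc] at h
      have h' := congrFun (congrFun h 0) 0
      simp only [Matrix.smul_apply, mul_smul_comm, mul_one, Matrix.one_apply_eq,
        smul_eq_mul] at h'
      exact mul_right_cancel₀ hc0 (by rw [← h']; ring)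
    intro s t
    have h := key s t
    rw [hbD, mul_smul] at h
    exact smul_right_injective _ (hdet0 0) h
  have hM' : ∀ s : Ga n, ((C c⁻¹ : MvPolynomial (Fin n) ℂ) • M).map (eval s) = c⁻¹ • ρ s := by
    intro s
    ext i j
    simp [ρ]
  refine ⟨(C c⁻¹ : MvPolynomial (Fin n) ℂ) • M, ?_, fun s t => ?_, fun s z hz => ?_⟩
  · rw [hM', hc, inv_smul_smul₀ hc0]
  · rw [hM', hM', hM', smul_mul_assoc, mul_smul_comm, hmul, inv_smul_smul₀ hc0]
  · obtain ⟨h, e⟩ := hM s z hz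
    rw [hM', Matrix.smul_mulVec]
    refine ⟨smul_ne_zero (inv_ne_zero hc0) h, ?_⟩
    rw [e, Projectivization.mk_eq_mk_iff']
    exact ⟨c, smul_inv_smul₀ hc0 _⟩

/-! ### Polynomial representations of `𝔾ₐⁿ` are exponentials -/

section Representation

variable {n r : ℕ} {M : Matrix (Fin r) (Fin r) (MvPolynomial (Fin n) ℂ)}

/-- The coefficient of `uᵏ` in the polynomial representation `u ↦ M(u s)`. -/
noncomputable def lineCoeff (M : Matrix (Fin r) (Fin r) (MvPolynomial (Fin n) ℂ)) (s : Ga n)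
    (k : ℕ) : Matrix (Fin r) (Fin r) ℂ :=
  M.map fun F => (restrictLine s F).coeff k

theorem lineCoeff_zero (h0 : M.map (eval 0) = 1) (s : Ga n) : lineCoeff M s 0 = 1 := by
  rw [← h0]
  ext i j
  simp only [lineCoeff, Matrix.map_apply]
  rw [Polynomial.coeff_zero_eq_eval_zero, eval_restrictLine, zero_smul]

theorem lineCoeff_one_smul (c : ℂ) (s : Ga n) :
    lineCoeff M (c • s) 1 = c • lineCoeff M s 1 := by
  ext i j
  have : restrictLine (c • s) (M i j) =
      (restrictLine s (M i j)).comp (Polynomial.C c * Polynomial.X) := by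
    refine Polynomial.funext fun u => ?_
    rw [eval_restrictLine, Polynomial.eval_comp, eval_restrictLine]
    simp [smul_smul, mul_comm u]
  simp only [lineCoeff, Matrix.map_apply, Matrix.smul_apply, this]
  rw [Polynomial.comp_C_mul_X_coeff, pow_one, mul_comm, smul_eq_mul]

theorem lineCoeff_one_add (h0 : M.map (eval 0) = 1)
    (hmul : ∀ s t : Ga n, M.map (eval (s + t)) = M.map (eval s) * M.map (eval t)) (s t : Ga n) :
    lineCoeff M (s + t) 1 = lineCoeff M s 1 + lineCoeff M t 1 := by
  have hpoly : ∀ i j, restrictLine (s + t) (M i j) =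
      ∑ l, restrictLine s (M i l) * restrictLine t (M l j) := by
    intro i j
    refine Polynomial.funext fun u => ?_
    have := congrFun (congrFun (hmul (u • s) (u • t)) i) j
    rw [← smul_add, Matrix.mul_apply] at this
    simp only [Matrix.map_apply] at this
    rw [eval_restrictLine, this, Polynomial.eval_finsetSum]
    simp only [Polynomial.eval_mul, eval_restrictLine]
  have hco : lineCoeff M (s + t) 1 =
      lineCoeff M s 0 * lineCoeff M t 1 + lineCoeff M s 1 * lineCoeff M t 0 := by
    ext i j
    simp only [lineCoeff, Matrix.map_apply, Matrix.add_apply, Matrix.mul_apply, hpoly,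
      Polynomial.finsetSum_coeff, Polynomial.mul_coeff_one, Finset.sum_add_distrib]
  rw [hco, lineCoeff_zero h0, lineCoeff_zero h0, one_mul, mul_one, add_comm]

/-- A matrix that commutes with `M(u s)` for every `u` commutes with the coefficients in `u`. -/
theorem commute_lineCoeff {B : Matrix (Fin r) (Fin r) ℂ} {s : Ga n}
    (hB : ∀ u : ℂ, Commute B (M.map (eval (u • s)))) (k : ℕ) : Commute B (lineCoeff M s k) := by
  have hpoly : ∀ i j, ∑ l, Polynomial.C (B i l) * restrictLine s (M l j) =
      ∑ l, restrictLine s (M i l) * Polynomial.C (B l j) := by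
    intro i j
    refine Polynomial.funext fun u => ?_
    have := congrFun (congrFun (hB u) i) j
    simp only [Matrix.mul_apply, Matrix.map_apply] at this
    simpa [Polynomial.eval_finsetSum, eval_restrictLine] using this
  refine Matrix.ext fun i j => ?_
  have := congrArg (fun p => Polynomial.coeff p k) (hpoly i j)
  simpa [lineCoeff, Matrix.mul_apply, Polynomial.finsetSum_coeff] using this

theorem commute_lineCoeff_one
    (hmul : ∀ s t : Ga n, M.map (eval (s + t)) = M.map (eval s) * M.map (eval t)) (s t : Ga n) :
    Commute (lineCoeff M s 1) (lineCoeff M t 1) := by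
  refine commute_lineCoeff (fun u => Commute.symm (commute_lineCoeff (fun v => ?_) 1)) 1
  rw [Commute, SemiconjBy, ← hmul, ← hmul, add_comm]

/-- The differential equation of a one-parameter group, in terms of coefficients. -/
theorem lineCoeff_succ
    (hmul : ∀ s t : Ga n, M.map (eval (s + t)) = M.map (eval s) * M.map (eval t)) (s : Ga n)
    (k : ℕ) : ((k : ℂ) + 1) • lineCoeff M s (k + 1) = lineCoeff M s 1 * lineCoeff M s k := by
  have hshift : ∀ (v : ℂ) i j, (restrictLine s (M i j)).comp (Polynomial.X + Polynomial.C v) =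
      ∑ l, restrictLine s (M i l) * Polynomial.C ((restrictLine s (M l j)).eval v) := by
    intro v i j
    refine Polynomial.funext fun u => ?_
    have := congrFun (congrFun (hmul (u • s) (v • s)) i) j
    rw [← add_smul, Matrix.mul_apply] at this
    simp only [Matrix.map_apply] at this
    rw [Polynomial.eval_comp, Polynomial.eval_add, Polynomial.eval_X, Polynomial.eval_C,
      eval_restrictLine, this, Polynomial.eval_finsetSum]
    simp only [Polynomial.eval_mul, Polynomial.eval_C, eval_restrictLine]
  have hderiv : ∀ i j, Polynomial.derivative (restrictLine s (M i j)) =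
      ∑ l, Polynomial.C ((restrictLine s (M i l)).coeff 1) * restrictLine s (M l j) := by
    intro i j
    refine Polynomial.funext fun v => ?_
    have := congrArg (fun p => (Polynomial.derivative p).eval 0) (hshift v i j)
    simp only [Polynomial.derivative_comp, Polynomial.derivative_sum, Polynomial.eval_finsetSum,
      Polynomial.derivative_mul, Polynomial.derivative_C, Polynomial.derivative_add,
      Polynomial.derivative_X, mul_zero, add_zero, one_mul, Polynomial.eval_mul,
      Polynomial.eval_C, Polynomial.eval_comp, Polynomial.eval_add, Polynomial.eval_X,
      zero_add] at this
    rw [this, Polynomial.eval_finsetSum]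
    refine Finset.sum_congr rfl fun l _ => ?_
    rw [← Polynomial.coeff_zero_eq_eval_zero, Polynomial.coeff_derivative]
    simp
  ext i j
  have := congrArg (fun p => Polynomial.coeff p k) (hderiv i j)
  simp only [Polynomial.coeff_derivative, Polynomial.finsetSum_coeff, Polynomial.coeff_C_mul]
    at this
  simp only [lineCoeff, Matrix.smul_apply, Matrix.mul_apply, Matrix.map_apply, smul_eq_mul]
  rw [← this, mul_comm]

theorem lineCoeff_eq_pow (h0 : M.map (eval 0) = 1)
    (hmul : ∀ s t : Ga n, M.map (eval (s + t)) = M.map (eval s) * M.map (eval t)) (s : Ga n)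
    (k : ℕ) : lineCoeff M s k = ((k.factorial : ℂ)⁻¹) • lineCoeff M s 1 ^ k := by
  induction k with
  | zero => simp [lineCoeff_zero h0]
  | succ k ih =>
    have hk : (k : ℂ) + 1 ≠ 0 := Nat.cast_add_one_ne_zero k
    have h := lineCoeff_succ hmul s k
    rw [ih, mul_smul_comm, ← pow_succ'] at h
    refine smul_right_injective _ hk ?_
    change ((k : ℂ) + 1) • lineCoeff M s (k + 1) = ((k : ℂ) + 1) • _
    rw [h, smul_smul, Nat.factorial_succ]
    congr 1
    push_cast
    field_simp

/-- A polynomial representation is the exponential of its derivative at the origin, which is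
nilpotent. -/
theorem exists_pow_eq_zero_and_eq_sum (h0 : M.map (eval 0) = 1)
    (hmul : ∀ s t : Ga n, M.map (eval (s + t)) = M.map (eval s) * M.map (eval t)) (s : Ga n) :
    ∃ K, lineCoeff M s 1 ^ K = 0 ∧
      M.map (eval s) = ∑ k ∈ Finset.range K, ((k.factorial : ℂ)⁻¹) • lineCoeff M s 1 ^ k := by
  obtain ⟨K, hK⟩ : ∃ K, ∀ i j, (restrictLine s (M i j)).natDegree < K := by
    obtain ⟨K, hK⟩ := (Set.finite_range fun p : Fin r × Fin r =>
      (restrictLine s (M p.1 p.2)).natDegree).bddAbove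
    exact ⟨K + 1, fun i j => Nat.lt_succ_of_le (hK ⟨(i, j), rfl⟩)⟩
  refine ⟨K, ?_, ?_⟩
  · have hz : lineCoeff M s K = 0 := by
      ext i j
      exact Polynomial.coeff_eq_zero_of_natDegree_lt (hK i j)
    rw [lineCoeff_eq_pow h0 hmul] at hz
    exact (smul_eq_zero.1 hz).resolve_left (inv_ne_zero (Nat.cast_ne_zero.2 K.factorial_ne_zero))
  · simp only [← lineCoeff_eq_pow h0 hmul]
    ext i j
    have := eval_restrictLine s (M i j) 1
    rw [one_smul, Polynomial.eval_eq_sum_range' (hK i j)] at this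
    simpa [lineCoeff, Matrix.sum_apply] using this.symm

/-- The derivative at the origin of a polynomial representation, as a linear map. -/
noncomputable def infinitesimal (M : Matrix (Fin r) (Fin r) (MvPolynomial (Fin n) ℂ))
    (h0 : M.map (eval 0) = 1)
    (hmul : ∀ s t : Ga n, M.map (eval (s + t)) = M.map (eval s) * M.map (eval t)) :
    Ga n →ₗ[ℂ] Matrix (Fin r) (Fin r) ℂ where
  toFun s := lineCoeff M s 1
  map_add' := lineCoeff_one_add h0 hmul
  map_smul' := lineCoeff_one_smul

end Representation

/-! ### The local algebra of an additive action -/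

theorem nilpExp_eq_sum {A : Type*} [CommRing A] [Algebra ℂ A] {a : A} {K : ℕ} (ha : a ^ K = 0) :
    nilpExp a = ∑ k ∈ Finset.range K, ((k.factorial : ℂ)⁻¹) • a ^ k := by
  refine Finset.sum_subset (Finset.range_mono (Nat.sInf_le ha)) ?_
  intro k _ hk
  rw [Finset.mem_range, not_lt] at hk
  rw [pow_eq_zero_of_le hk (pow_nilpotencyClass ⟨K, ha⟩), smul_zero]

theorem localAlgebraActionInCoordinates_mk (A : Type*) [CommRing A] [Algebra ℂ A] [IsLocalRing A]
    [FiniteDimensional ℂ A] {n : ℕ} (ε : Ga n ≃ₗ[ℂ] IsLocalRing.maximalIdeal A)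
    (e : (Fin (n + 1) → ℂ) ≃ₗ[ℂ] A) (s : Ga n) {z : Fin (n + 1) → ℂ} (hz : z ≠ 0) :
    ∃ h : e.symm (nilpExp (ε s : A) * e z) ≠ 0,
      localAlgebraActionInCoordinates A ε e s (Projectivization.mk ℂ z hz) =
        Projectivization.mk ℂ _ h := by
  refine ⟨?_, rfl⟩
  rw [Ne, LinearEquiv.map_eq_zero_iff, (isUnit_nilpExp A (ε s)).mul_right_eq_zero,
    LinearEquiv.map_eq_zero_iff]
  exact hz

section NilpotentGenerators

variable {A : Type*} [CommRing A] [Algebra ℂ A] {S : Set A}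

/-- An algebra generated by nilpotent elements is `ℂ` plus its nilpotent elements. -/
theorem exists_isNilpotent_sub_algebraMap (hS : Algebra.adjoin ℂ S = ⊤)
    (hnil : ∀ a ∈ S, IsNilpotent a) (a : A) : ∃ c : ℂ, IsNilpotent (a - algebraMap ℂ A c) := by
  have ha : a ∈ Algebra.adjoin ℂ S := hS ▸ Algebra.mem_top
  induction ha using Algebra.adjoin_induction with
  | mem x hx => exact ⟨0, by simpa using hnil x hx⟩
  | algebraMap r => exact ⟨r, by simp⟩
  | add x y _ _ hx hy =>
    obtain ⟨c, hc⟩ := hx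
    obtain ⟨d, hd⟩ := hy
    refine ⟨c + d, ?_⟩
    have := (Commute.all _ _).isNilpotent_add hc hd
    rwa [sub_add_sub_comm, ← map_add] at this
  | mul x y _ _ hx hy =>
    obtain ⟨c, hc⟩ := hx
    obtain ⟨d, hd⟩ := hy
    refine ⟨c * d, ?_⟩
    have h1 := (Commute.all _ y).isNilpotent_mul_right hc
    have h2 := (Commute.all _ (algebraMap ℂ A c)).isNilpotent_mul_right hd
    have := (Commute.all _ _).isNilpotent_add h1 h2
    rw [map_mul]
    convert this using 1
    ring

theorem isUnit_of_isNilpotent_sub_algebraMap {a : A} {c : ℂ} (hc : c ≠ 0)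
    (ha : IsNilpotent (a - algebraMap ℂ A c)) : IsUnit a := by
  have := ha.isUnit_add_left_of_commute ((isUnit_iff_ne_zero.2 hc).map (algebraMap ℂ A))
    (Commute.all _ _)
  rwa [add_sub_cancel] at this

theorem isLocalRing_of_adjoin_isNilpotent [Nontrivial A] (hS : Algebra.adjoin ℂ S = ⊤)
    (hnil : ∀ a ∈ S, IsNilpotent a) : IsLocalRing A := by
  refine IsLocalRing.of_isUnit_or_isUnit_one_sub_self fun a => ?_
  obtain ⟨c, hc⟩ := exists_isNilpotent_sub_algebraMap hS hnil a
  by_cases h : c = 0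
  · subst h
    right
    rw [map_zero, sub_zero] at hc
    exact hc.isUnit_one_sub
  · exact Or.inl (isUnit_of_isNilpotent_sub_algebraMap h hc)

theorem finrank_maximalIdeal_add_one [IsLocalRing A] [FiniteDimensional ℂ A]
    (hS : Algebra.adjoin ℂ S = ⊤) (hnil : ∀ a ∈ S, IsNilpotent a) :
    Module.finrank ℂ (IsLocalRing.maximalIdeal A) + 1 = Module.finrank ℂ A := by
  let m : Submodule ℂ A := (IsLocalRing.maximalIdeal A).restrictScalars ℂ
  have hm : ∀ a : A, a ∈ m ↔ ¬ IsUnit a := fun a => IsLocalRing.mem_maximalIdeal a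
  have hq : Module.finrank ℂ (A ⧸ m) = 1 := by
    rw [finrank_eq_one_iff']
    refine ⟨m.mkQ 1, ?_, fun w => ?_⟩
    · rw [Ne, Submodule.mkQ_apply, Submodule.Quotient.mk_eq_zero, hm, not_not]
      exact isUnit_one
    · obtain ⟨a, rfl⟩ := m.mkQ_surjective w
      obtain ⟨c, hc⟩ := exists_isNilpotent_sub_algebraMap hS hnil a
      refine ⟨c, ?_⟩
      rw [← map_smul, ← sub_eq_zero, ← map_sub, Submodule.mkQ_apply, Submodule.Quotient.mk_eq_zero,
        ← neg_mem_iff, neg_sub, ← Algebra.algebraMap_eq_smul_one, hm]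
      exact hc.not_isUnit
  have := m.finrank_quotient_add_finrank
  rw [hq, add_comm] at this
  exact this

end NilpotentGenerators

/-- The subalgebra generated by commuting elements, as a commutative ring with its inclusion `j`. -/
theorem exists_commRing_adjoin {B : Type} [Ring B] [Algebra ℂ B] (S : Set B)
    (hS : ∀ x ∈ S, ∀ y ∈ S, x * y = y * x) :
    ∃ (A : Type) (_ : CommRing A) (_ : Algebra ℂ A) (j : A →ₐ[ℂ] B), Function.Injective j ∧
      Algebra.adjoin ℂ (j ⁻¹' S) = ⊤ ∧ ∀ x ∈ S, ∃ a, j a = x := by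
  have hc := Algebra.isMulCommutative_adjoin ℂ hS
  let : CommRing (Algebra.adjoin ℂ S) :=
    { (inferInstance : Ring (Algebra.adjoin ℂ S)) with
      mul_comm := hc.is_comm.comm }
  exact ⟨Algebra.adjoin ℂ S, inferInstance, inferInstanceAs (Algebra ℂ (Algebra.adjoin ℂ S)),
    (Algebra.adjoin ℂ S).val, Subtype.val_injective, Algebra.adjoin_adjoin_coe_preimage,
    fun x hx => ⟨⟨x, Algebra.subset_adjoin hx⟩, rfl⟩⟩

/-- The Hassett–Tschinkel correspondence: the matrices of the Lie algebra of `𝔾ₐⁿ` generate a local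
algebra `A`, and a vector `v` over a point of the open orbit is cyclic, so that `a ↦ a v`
identifies `A` with the ambient vector space. -/
theorem IsAdditiveAction.exists_localAlgebra {n : ℕ} (hn : 1 ≤ n) {α : Ga n → Proj n → Proj n}
    (hα : IsAdditiveAction α) :
    ∃ (A : Type) (_ : CommRing A) (_ : Algebra ℂ A) (_ : IsLocalRing A)
      (_ : FiniteDimensional ℂ A), Module.finrank ℂ A = n + 1 ∧
      ∃ (ε : Ga n ≃ₗ[ℂ] IsLocalRing.maximalIdeal A) (e : (Fin (n + 1) → ℂ) ≃ₗ[ℂ] A),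
        α = localAlgebraActionInCoordinates A ε e := by
  obtain ⟨M, h0, hmul, hM⟩ := hα.exists_representation hn
  let N := infinitesimal M h0 hmul
  have hcomm : ∀ x ∈ Set.range N, ∀ y ∈ Set.range N, x * y = y * x := by
    rintro _ ⟨s, rfl⟩ _ ⟨t, rfl⟩
    exact commute_lineCoeff_one hmul s t
  have hexp : ∀ s, ∃ K, N s ^ K = 0 ∧
      M.map (eval s) = ∑ k ∈ Finset.range K, ((k.factorial : ℂ)⁻¹) • N s ^ k :=
    exists_pow_eq_zero_and_eq_sum h0 hmul
  obtain ⟨A, _, _, j, hj, hgen, hrange⟩ := exists_commRing_adjoin (Set.range N) hcomm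
  have hnil : ∀ a ∈ j ⁻¹' Set.range N, IsNilpotent a := by
    rintro a ⟨s, hs⟩
    obtain ⟨K, hK, -⟩ := hexp s
    exact ⟨K, hj (by rw [map_pow, ← hs, hK, map_zero])⟩
  have : Nontrivial A := j.toRingHom.domain_nontrivial
  have : FiniteDimensional ℂ A := FiniteDimensional.of_injective j.toLinearMap hj
  have : IsLocalRing A := isLocalRing_of_adjoin_isNilpotent hgen hnil
  choose ν hν using fun s => hrange (N s) ⟨s, rfl⟩
  have hνmem : ∀ s, ν s ∈ IsLocalRing.maximalIdeal A := by
    intro s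
    rw [IsLocalRing.mem_maximalIdeal]
    exact (hnil (ν s) ⟨s, (hν s).symm⟩).not_isUnit
  have hexpj : ∀ s, j (nilpExp (ν s)) = M.map (eval s) := by
    intro s
    obtain ⟨K, hK, hsum⟩ := hexp s
    rw [nilpExp_eq_sum (K := K) (hj (by rw [map_pow, hν, hK, map_zero])), hsum, map_sum]
    refine Finset.sum_congr rfl fun k _ => ?_
    rw [map_smul, map_pow, hν]
  obtain ⟨x, hx⟩ := hα.open_orbit
  induction x using Projectivization.ind with
  | h v hv =>
  let ev : A →ₗ[ℂ] (Fin (n + 1) → ℂ) :=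
    { toFun := fun a => (j a).mulVec v
      map_add' := fun a b => by rw [map_add, Matrix.add_mulVec]
      map_smul' := fun c a => by rw [map_smul, Matrix.smul_mulVec, RingHom.id_apply] }
  have hev : ∀ a b, ev (a * b) = (j a).mulVec (ev b) := by
    intro a b
    change (j (a * b)).mulVec v = (j a).mulVec ((j b).mulVec v)
    rw [map_mul, Matrix.mulVec_mulVec]
  have hsurj : Function.Surjective ev := by
    rw [← LinearMap.range_eq_top]
    by_contra hne
    obtain ⟨l, hl, hle⟩ := Submodule.exists_le_ker_of_lt_top _ (lt_top_iff_ne_top.2 hne)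
    obtain ⟨z, hz, ⟨s, hs⟩, hlz⟩ := not_subset_hyperplane hx ⟨_, 0, rfl⟩ l hl
    obtain ⟨h, e⟩ := hM s v hv
    change α s _ = _ at hs
    rw [e, Projectivization.mk_eq_mk_iff'] at hs
    obtain ⟨c, hc⟩ := hs
    have hker : l (ev (nilpExp (ν s))) = 0 := hle ⟨_, rfl⟩
    change l ((j (nilpExp (ν s))).mulVec v) = 0 at hker
    rw [hexpj, ← hc, map_smul, smul_eq_zero] at hker
    rcases hker with rfl | h1
    · rw [zero_smul] at hc
      exact h hc.symm
    · exact hlz h1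
  have hinj : Function.Injective ev := by
    rw [injective_iff_map_eq_zero]
    intro a ha
    refine hj ?_
    rw [map_zero]
    refine Matrix.ext_of_mulVec_single fun i => ?_
    obtain ⟨b, hb⟩ := hsurj (Pi.single i 1)
    rw [← hb, ← hev, mul_comm, hev, ha, Matrix.mulVec_zero, Matrix.zero_mulVec]
  let e : (Fin (n + 1) → ℂ) ≃ₗ[ℂ] A := (LinearEquiv.ofBijective ev ⟨hinj, hsurj⟩).symm
  have hfin : Module.finrank ℂ A = n + 1 := by
    rw [← e.finrank_eq, Module.finrank_fin_fun]
  let νlin : Ga n →ₗ[ℂ] IsLocalRing.maximalIdeal A :=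
    { toFun := fun s => ⟨ν s, hνmem s⟩
      map_add' := fun s t => Subtype.ext (hj (by
        change j (ν (s + t)) = j (ν s + ν t)
        rw [map_add, hν, hν, hν, map_add]))
      map_smul' := fun c s => Subtype.ext (hj (by
        change j (ν (c • s)) = j (c • ν s)
        rw [map_smul, hν, hν, map_smul])) }
  have hνinj : Function.Injective νlin := by
    rw [injective_iff_map_eq_zero]
    intro s hs
    have hνs : ν s = 0 := congrArg Subtype.val hs
    have h1 : M.map (eval s) = 1 := by
      rw [← hexpj, hνs, nilpExp_eq_sum (K := 1) (by simp)]
      simp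
    refine hα.effective s fun x => ?_
    induction x using Projectivization.ind with
    | h z hz =>
    obtain ⟨h, e⟩ := hM s z hz
    rw [e, Projectivization.mk_eq_mk_iff']
    exact ⟨1, by rw [h1, Matrix.one_mulVec, one_smul]⟩
  have hdim : Module.finrank ℂ (Ga n) = Module.finrank ℂ (IsLocalRing.maximalIdeal A) := by
    have := finrank_maximalIdeal_add_one hgen hnil
    rw [hfin] at this
    rw [Module.finrank_fin_fun]
    omega
  let ε := νlin.linearEquivOfInjective hνinj hdim
  refine ⟨A, _, _, ‹_›, ‹_›, hfin, ε, e, ?_⟩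
  funext s x
  induction x using Projectivization.ind with
  | h z hz =>
  obtain ⟨h, e1⟩ := hM s z hz
  obtain ⟨h', e2⟩ := localAlgebraActionInCoordinates_mk A ε e s hz
  rw [e1, e2, Projectivization.mk_eq_mk_iff']
  refine ⟨1, ?_⟩
  rw [one_smul]
  change ev (nilpExp (ν s) * e z) = _
  rw [hev, hexpj]
  congr 1
  exact (LinearEquiv.ofBijective ev ⟨hinj, hsurj⟩).apply_symm_apply z

/-! ### The OP-condition for the action of a local algebra -/

theorem linearIndependent_pow_of_pow_ne_zero {A : Type*} [CommRing A] [Algebra ℂ A]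
    [FiniteDimensional ℂ A] {m : A} {d : ℕ} (hd : m ^ d ≠ 0) (hnil : IsNilpotent m) :
    LinearIndependent ℂ fun i : Fin (d + 1) => m ^ (i : ℕ) := by
  obtain ⟨K, hK⟩ := hnil
  have hdvd : minpoly ℂ m ∣ Polynomial.X ^ K := minpoly.dvd _ _ (by simpa using hK)
  obtain ⟨j, -, hj⟩ := (dvd_prime_pow Polynomial.prime_X K).1 hdvd
  have hmin : minpoly ℂ m = Polynomial.X ^ j :=
    Polynomial.eq_of_monic_of_associated (minpoly.monic (Algebra.IsIntegral.isIntegral m))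
      (Polynomial.monic_X_pow j) hj
  have hmj : m ^ j = 0 := by
    have := minpoly.aeval ℂ m
    rwa [hmin, map_pow, Polynomial.aeval_X] at this
  have hdj : d + 1 ≤ (minpoly ℂ m).natDegree := by
    rw [hmin, Polynomial.natDegree_X_pow]
    by_contra h
    exact hd (pow_eq_zero_of_le (by omega) hmj)
  exact (linearIndependent_pow (K := ℂ) m).comp (Fin.castLE hdj) (Fin.castLE_injective hdj)

/-- The closure of the curve `[exp(t m) a]` has no point on the hyperplane of the maximal ideal other
than `[mᵈ a]`, where `mᵈ` is the last nonzero power. The curve is a rational normal curve, and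
its equations `c_j² = c_i c_k`, `i + k = 2 j`, say so. -/
theorem mul_self_eq_zero_of_mem_closure {A : Type*} [CommRing A] [Algebra ℂ A] [IsLocalRing A]
    [FiniteDimensional ℂ A] {n : ℕ} (e : (Fin (n + 1) → ℂ) ≃ₗ[ℂ] A) {m a b : A}
    (hm : m ∈ IsLocalRing.maximalIdeal A) (ha : IsUnit a) (hb : b ∈ IsLocalRing.maximalIdeal A)
    {S : Set (Proj n)}
    (hS : ∀ q ∈ S, ∃ (t : ℂ) (h : e.symm (nilpExp (t • m) * a) ≠ 0), q = Projectivization.mk ℂ _ h)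
    (hb0 : e.symm b ≠ 0) (hcl : Projectivization.mk ℂ _ hb0 ∈ closure[zariski n] S) :
    b * b = 0 := by
  have hnil : IsNilpotent m := isNilpotent_of_mem_maximalIdeal A ⟨m, hm⟩
  obtain ⟨d, hd⟩ : ∃ d, nilpotencyClass m = d + 1 :=
    Nat.exists_eq_succ_of_ne_zero (pos_nilpotencyClass_iff.2 hnil).ne'
  have hmd1 : m ^ (d + 1) = 0 := hd ▸ pow_nilpotencyClass hnil
  have hmd : m ^ d ≠ 0 := fun h => by
    have : nilpotencyClass m ≤ d := Nat.sInf_le h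
    omega
  let v : Fin (d + 1) → A := fun i => (((i : ℕ).factorial : ℂ)⁻¹) • (m ^ (i : ℕ) * a)
  have hfac : ∀ i : ℕ, ((i.factorial : ℂ)⁻¹) ≠ 0 := fun i =>
    inv_ne_zero (Nat.cast_ne_zero.2 i.factorial_ne_zero)
  have hv : LinearIndependent ℂ v := by
    have h1 := (linearIndependent_pow_of_pow_ne_zero hmd hnil).map' (LinearMap.mulRight ℂ a)
      (LinearMap.ker_eq_bot.2 ha.mul_left_injective)
    exact h1.units_smul fun i => Units.mk0 _ (hfac i)
  let T : (Fin (d + 1) → ℂ) →ₗ[ℂ] A := Fintype.linearCombination ℂ v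
  have hT : ∀ c, T c = ∑ i, c i • v i := fun c => Fintype.linearCombination_apply ℂ v c
  obtain ⟨L, hL⟩ := T.exists_leftInverse_of_injective
    (LinearMap.ker_eq_bot.2 hv.fintypeLinearCombination_injective)
  have hLT : ∀ c, L (T c) = c := fun c => LinearMap.congr_fun hL c
  have hcurve : ∀ t : ℂ, nilpExp (t • m) * a = T fun i => t ^ (i : ℕ) := by
    intro t
    rw [nilpExp_eq_sum (K := d + 1) (by rw [smul_pow, hmd1, smul_zero]), hT, Finset.sum_mul,
      Finset.sum_range]
    refine Finset.sum_congr rfl fun i _ => ?_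
    simp only [v]
    rw [smul_pow, smul_mul_assoc, smul_mul_assoc, smul_comm]
  have hvanish : ∀ (f : MvPolynomial (Fin (n + 1)) ℂ) (r : ℕ), f.IsHomogeneous r →
      (∀ t : ℂ, eval (e.symm (T fun i => t ^ (i : ℕ))) f = 0) → eval (e.symm b) f = 0 := by
    intro f r hf h
    by_contra hne
    obtain ⟨q, hqf, hqS⟩ := mem_zariski_closure_iff.1 hcl f r hf ((mk_mem_basicOpen hf hb0).2 hne)
    obtain ⟨t, ht, rfl⟩ := hS q hqS
    rw [mk_mem_basicOpen hf, hcurve] at hqf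
    exact hqf (h t)
  -- the linear equations of the span of the curve
  have hspan : T (L b) = b := by
    refine e.symm.injective (funext fun i => ?_)
    let l : (Fin (n + 1) → ℂ) →ₗ[ℂ] ℂ :=
      LinearMap.proj i ∘ₗ e.symm.toLinearMap ∘ₗ (T ∘ₗ L - LinearMap.id) ∘ₗ e.toLinearMap
    have hl : ∀ y, l (e.symm y) = e.symm (T (L y)) i - e.symm y i := by
      intro y
      simp [l]
    have := hvanish _ _ (isHomogeneous_linearFormPoly l) fun t => by
      rw [eval_linearFormPoly, hl, hLT, sub_self]
    rwa [eval_linearFormPoly, hl, sub_eq_zero] at this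
  have hquad : ∀ i j k : Fin (d + 1), (i : ℕ) + k = 2 * j → L b j ^ 2 = L b i * L b k := by
    intro i j k hijk
    let p (i : Fin (d + 1)) := linearFormPoly (LinearMap.proj i ∘ₗ L ∘ₗ e.toLinearMap)
    have hp : ∀ i y, eval (e.symm y) (p i) = L y i := by
      intro i y
      rw [eval_linearFormPoly]
      simp
    have hp1 : ∀ i, (p i).IsHomogeneous 1 := fun i => isHomogeneous_linearFormPoly _
    have := hvanish (p j ^ 2 - p i * p k) 2
      (((hp1 j).pow 2).sub ((hp1 i).mul (hp1 k))) fun t => by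
        rw [map_sub, map_pow, map_mul, hp, hp, hp, hLT, ← pow_mul, ← pow_add, hijk, mul_comm 2,
          sub_self]
    rwa [map_sub, map_pow, map_mul, hp, hp, hp, sub_eq_zero] at this
  rw [hT] at hspan
  have hc0 : L b 0 = 0 := by
    by_contra hne
    rw [Fin.sum_univ_succ] at hspan
    have hrest : ∑ i : Fin d, L b i.succ • v i.succ ∈ IsLocalRing.maximalIdeal A := by
      refine Ideal.sum_mem _ fun i _ => Submodule.smul_of_tower_mem _ _
        (Submodule.smul_of_tower_mem _ _ (Ideal.mul_mem_right _ _ ?_))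
      exact Ideal.pow_mem_of_mem _ hm _ (by simp)
    rw [← hspan, Ideal.add_mem_iff_left _ hrest] at hb
    have h2 : a ∈ IsLocalRing.maximalIdeal A := by
      have := Submodule.smul_of_tower_mem (IsLocalRing.maximalIdeal A) (L b 0)⁻¹ hb
      rw [inv_smul_smul₀ hne] at this
      simpa [v] using this
    exact (IsLocalRing.mem_maximalIdeal _).1 h2 ha
  have hcz : ∀ i : ℕ, ∀ hi : i < d, L b ⟨i, by omega⟩ = 0 := by
    intro i
    induction i with
    | zero => exact fun _ => hc0
    | succ i ih =>
      intro hi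
      have := hquad ⟨i, by omega⟩ ⟨i + 1, by omega⟩ ⟨i + 2, by omega⟩ (by simp; ring)
      rw [ih (by omega), zero_mul] at this
      exact pow_eq_zero_iff two_ne_zero |>.1 this
  rw [Fin.sum_univ_castSucc, Finset.sum_eq_zero, zero_add] at hspan
  · by_cases hd0 : d = 0
    · subst hd0
      rw [← hspan]
      change (L b 0 • _) * _ = 0
      rw [hc0, zero_smul, zero_mul]
    · have hmm : m ^ d * m ^ d = 0 := by
        rw [← pow_add]
        exact pow_eq_zero_of_le (by omega) hmd1
      rw [← hspan]
      simp only [v, Fin.val_last, smul_mul_assoc, mul_smul_comm]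
      rw [mul_mul_mul_comm, hmm, zero_mul]
      simp
  · intro i _
    have := hcz i i.2
    change L b ⟨i, _⟩ • _ = 0
    rw [this, zero_smul]

/-- If `[a]` has an open orbit, then `a` is invertible, because otherwise the orbit lies in the
hyperplane of the maximal ideal. -/
theorem isUnit_of_isOpen_orbit {A : Type*} [CommRing A] [Algebra ℂ A] [IsLocalRing A]
    [FiniteDimensional ℂ A] {n : ℕ} {ε : Ga n ≃ₗ[ℂ] IsLocalRing.maximalIdeal A}
    {e : (Fin (n + 1) → ℂ) ≃ₗ[ℂ] A} {z : Fin (n + 1) → ℂ} {hz : z ≠ 0}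
    (h : IsOpen[zariski n]
      (orbit (localAlgebraActionInCoordinates A ε e) (Projectivization.mk ℂ z hz))) :
    IsUnit (e z) := by
  by_contra hu
  rw [← mem_nonunits_iff, ← IsLocalRing.mem_maximalIdeal] at hu
  let m : Submodule ℂ A := (IsLocalRing.maximalIdeal A).restrictScalars ℂ
  have h1 : (1 : A) ∉ m := fun h1 => (IsLocalRing.mem_maximalIdeal _).1 h1 isUnit_one
  obtain ⟨l, hl, hlm⟩ := m.exists_le_ker_of_notMem h1
  have hl' : l ∘ₗ e.toLinearMap ≠ 0 := by
    intro h0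
    refine hl ?_
    have := LinearMap.congr_fun h0 (e.symm 1)
    simpa using this
  obtain ⟨w, hw, ⟨s, hs⟩, hlw⟩ := not_subset_hyperplane h ⟨_, 0, rfl⟩ _ hl'
  obtain ⟨h', e'⟩ := localAlgebraActionInCoordinates_mk A ε e s hz
  change localAlgebraActionInCoordinates A ε e s _ = _ at hs
  rw [e', eq_comm, Projectivization.mk_eq_mk_iff'] at hs
  obtain ⟨c, hc⟩ := hs
  refine hlw ?_
  have hmem : nilpExp (ε s : A) * e z ∈ m := Ideal.mul_mem_left _ _ hu
  have h0 : l (nilpExp (ε s : A) * e z) = 0 := hlm hmem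
  rw [← hc]
  simp [h0]

theorem ideal_sq_eq_bot_of_mul_self {A : Type*} [CommRing A] [Algebra ℂ A] {I : Ideal A}
    (hI : ∀ y ∈ I, y * y = 0) : I ^ 2 = ⊥ := by
  rw [pow_two, eq_bot_iff, Ideal.mul_le]
  intro r hr s hs
  have h := hI _ (I.add_mem hr hs)
  have h2 : (2 : ℂ) • (r * s) = 0 := by
    rw [two_smul]
    linear_combination h - hI r hr - hI s hs
  exact (smul_eq_zero.1 h2).resolve_left two_ne_zero

theorem maximalIdeal_sq_eq_bot_of_opCondition {A : Type*} [CommRing A] [Algebra ℂ A]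
    [IsLocalRing A] [FiniteDimensional ℂ A] {n : ℕ} {α : Ga n → Proj n → Proj n}
    (hα : OPCondition α) (hA : CorrespondsTo A α) : IsLocalRing.maximalIdeal A ^ 2 = ⊥ := by
  obtain ⟨ε, e, φ, ψ, hφ, -, hψ, hψ', hαβ⟩ := hA
  refine ideal_sq_eq_bot_of_mul_self fun y hy => ?_
  by_cases hy0 : y = 0
  · rw [hy0, zero_mul]
  have hy' : e.symm y ≠ 0 := by simpa using hy0
  obtain ⟨x, hx, H, hH, w, hw, s, hs⟩ := hα (ψ.symm (Projectivization.mk ℂ _ hy'))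
  have hψw := congrArg ψ hs
  simp only [hαβ, Equiv.apply_symm_apply] at hψw
  obtain ⟨hb0, hbe⟩ := localAlgebraActionInCoordinates_mk A ε e (φ s) hy'
  rw [hbe] at hψw
  have hopen : IsOpen[zariski n] (orbit (localAlgebraActionInCoordinates A ε e) (ψ x)) := by
    have : orbit (localAlgebraActionInCoordinates A ε e) (ψ x) = ψ.symm ⁻¹' orbit α x := by
      ext p
      constructor
      · rintro ⟨t, rfl⟩
        exact ⟨φ.symm t, by simp [Equiv.eq_symm_apply, hαβ]⟩
      · rintro ⟨t, ht⟩
        refine ⟨φ t, ?_⟩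
        change localAlgebraActionInCoordinates A ε e (φ t) (ψ x) = p
        rw [← hαβ, ← Equiv.eq_symm_apply]
        exact ht
    rw [this]
    let := zariski n
    exact hx.preimage hψ'.continuous
  have hclosure : ψ w ∈ closure[zariski n] (ψ '' ((fun s => α s x) '' (H : Set (Ga n)))) := by
    let := zariski n
    exact image_closure_subset_closure_image hψ.continuous ⟨w, hw, rfl⟩
  generalize hpx : ψ x = px at hopen
  induction px using Projectivization.ind with
  | h z hz =>
  have hunit := isUnit_of_isOpen_orbit hopen
  obtain ⟨h, hh⟩ := exists_eq_span_of_isOneDimAlgebraicSubgroup hH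
  have hE := isUnit_nilpExp A (ε (φ s))
  rw [← hψw] at hclosure
  have key := mul_self_eq_zero_of_mem_closure e (m := ε (φ h)) (a := e z)
    (b := nilpExp (ε (φ s) : A) * y) (ε (φ h)).2 hunit (Ideal.mul_mem_left _ _ hy)
    (S := ψ '' ((fun s => α s x) '' (H : Set (Ga n)))) ?_ (by simpa using hb0)
    (by simpa using hclosure)
  · rw [mul_mul_mul_comm, (hE.mul hE).mul_right_eq_zero] at key
    exact key
  · rintro _ ⟨_, ⟨t, ht, rfl⟩, rfl⟩
    obtain ⟨c, rfl⟩ := hh t ht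
    have hlin : φ (c • h) = c • φ h :=
      IsPolynomialMap.map_smul_of_addMonoidHom φ.toAddMonoidHom hφ c h
    obtain ⟨h1, e1⟩ := localAlgebraActionInCoordinates_mk A ε e (c • φ h) hz
    refine ⟨c, ?_, ?_⟩
    · simpa using h1
    · change ψ (α (c • h) x) = _
      rw [hαβ, hpx, hlin, e1]
      congr 1
      simp

/-! ### Algebras with `𝔪² = 0` -/

/-- The automorphism of `ℙⁿ` that a linear automorphism of `ℂⁿ⁺¹` induces. -/
noncomputable def projEquiv {n : ℕ} (g : (Fin (n + 1) → ℂ) ≃ₗ[ℂ] (Fin (n + 1) → ℂ)) :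
    Proj n ≃ Proj n where
  toFun := Projectivization.map g.toLinearMap g.injective
  invFun := Projectivization.map g.symm.toLinearMap g.symm.injective
  left_inv p := by
    induction p using Projectivization.ind with
    | h z hz => simp [Projectivization.map_mk]
  right_inv p := by
    induction p using Projectivization.ind with
    | h z hz => simp [Projectivization.map_mk]

theorem isRegularMap_projEquiv {n : ℕ} (g : (Fin (n + 1) → ℂ) ≃ₗ[ℂ] (Fin (n + 1) → ℂ)) :
    IsRegularMap (projEquiv g) := by
  intro z₀ hz₀
  have hev : ∀ z, (fun j => eval z (linearFormPoly (LinearMap.proj j ∘ₗ g.toLinearMap))) = g z :=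
    fun z => funext fun j => by rw [eval_linearFormPoly]; rfl
  refine ⟨1, fun j => linearFormPoly (LinearMap.proj j ∘ₗ g.toLinearMap),
    fun j => isHomogeneous_linearFormPoly _, ?_, fun z hz hF => ?_⟩
  · rw [hev]
    simpa using hz₀
  · exact mk_congr (hev z).symm _ _

theorem equivalent_of_linearEquiv {n : ℕ} {α β : Ga n → Proj n → Proj n}
    (g : (Fin (n + 1) → ℂ) ≃ₗ[ℂ] (Fin (n + 1) → ℂ))
    (h : ∀ s x, projEquiv g (α s x) = β s (projEquiv g x)) : Equivalent α β := by
  have hid : IsPolynomialMap (id : Ga n → Ga n) := ⟨X, fun s j => (eval_X j).symm⟩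
  exact ⟨AddEquiv.refl _, projEquiv g, hid, hid, isRegularMap_projEquiv g,
    isRegularMap_projEquiv g.symm, h⟩

/-- If `𝔪² = 0` then `exp m = 1 + m`, and `(1 + m)(z₀ + m') = z₀ + (m' + z₀ m)`. -/
theorem equivalent_translationAction_of_sq_eq_bot {A : Type*} [CommRing A] [Algebra ℂ A]
    [IsLocalRing A] [FiniteDimensional ℂ A] {n : ℕ} (ε : Ga n ≃ₗ[ℂ] IsLocalRing.maximalIdeal A)
    (e : (Fin (n + 1) → ℂ) ≃ₗ[ℂ] A) (hA : IsLocalRing.maximalIdeal A ^ 2 = ⊥) :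
    Equivalent (localAlgebraActionInCoordinates A ε e) (translationAction n) := by
  have hmul : ∀ s t, (ε s : A) * ε t = 0 := by
    intro s t
    have := Ideal.mul_mem_mul (ε s).2 (ε t).2
    rwa [← pow_two, hA] at this
  have hexp : ∀ s, nilpExp (ε s : A) = 1 + ε s := by
    intro s
    rw [nilpExp_eq_sum (K := 2) (by rw [pow_two, hmul])]
    simp [Finset.sum_range_succ]
  let T : (Fin (n + 1) → ℂ) →ₗ[ℂ] A :=
    { toFun := fun z => algebraMap ℂ A (z 0) + ε fun i => z i.succ
      map_add' := fun z w => by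
        change algebraMap ℂ A (z 0 + w 0) + (ε ((fun i => z i.succ) + fun i => w i.succ) : A) = _
        rw [map_add, map_add, Submodule.coe_add]
        ring
      map_smul' := fun c z => by
        change algebraMap ℂ A (c * z 0) + (ε (c • fun i => z i.succ) : A) = _
        rw [map_mul, map_smul, RingHom.id_apply, smul_add, Algebra.smul_def]
        rfl }
  have hTdef : ∀ z, T z = algebraMap ℂ A (z 0) + ε fun i => z i.succ := fun z => rfl
  have hTinj : Function.Injective T := by
    rw [injective_iff_map_eq_zero]
    intro z hz
    rw [hTdef] at hz
    have h0 : z 0 = 0 := by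
      by_contra hne
      have hu : IsUnit (algebraMap ℂ A (z 0)) := (isUnit_iff_ne_zero.2 hne).map _
      rw [eq_neg_of_add_eq_zero_left hz, IsUnit.neg_iff] at hu
      exact (IsLocalRing.mem_maximalIdeal _).1 (ε fun i => z i.succ).2 hu
    rw [h0, map_zero, zero_add] at hz
    have h1 : (fun i : Fin n => z i.succ) = 0 := by simpa using hz
    funext j
    exact Fin.cases h0 (fun i => congrFun h1 i) j
  let g : (Fin (n + 1) → ℂ) ≃ₗ[ℂ] A := T.linearEquivOfInjective hTinj e.finrank_eq
  have hg : ∀ z, g z = T z := fun z => rfl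
  have htrans : ∀ s z, nilpExp (ε s : A) * g z = g (translationLinear s z) := by
    intro s z
    rw [hg, hg, hTdef, hTdef, hexp, translationLinear_apply_zero]
    have : (fun i => translationLinear s z i.succ) = (fun i : Fin n => z i.succ) + z 0 • s := by
      funext i
      rw [translationLinear_apply_succ, Pi.add_apply, Pi.smul_apply, smul_eq_mul, mul_comm]
    rw [this, map_add, map_smul, Submodule.coe_add]
    change _ = _ + (_ + (z 0 • (ε s : A)))
    rw [Algebra.smul_def]
    linear_combination hmul s fun i => z i.succ
  refine equivalent_of_linearEquiv (e.trans g.symm) fun s x => ?_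
  induction x using Projectivization.ind with
  | h z hz =>
  obtain ⟨h, e1⟩ := localAlgebraActionInCoordinates_mk A ε e s hz
  rw [e1]
  refine mk_congr ?_ _ _
  change g.symm (e (e.symm (nilpExp (ε s : A) * e z))) = translationLinear s (g.symm (e z))
  rw [e.apply_symm_apply, LinearEquiv.symm_apply_eq, ← htrans, g.apply_symm_apply]

end AdditiveActions

theorem mainTheorem3 (n : ℕ) (hn : 1 ≤ n) :
    (∀ α : AdditiveActions.Ga n → AdditiveActions.Proj n → AdditiveActions.Proj n,
      AdditiveActions.IsAdditiveAction α → AdditiveActions.OPCondition α →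
        AdditiveActions.Equivalent α (AdditiveActions.translationAction n) ∧
        (∃ (A : Type) (_ : CommRing A) (_ : Algebra ℂ A) (_ : IsLocalRing A)
            (_ : FiniteDimensional ℂ A),
          Module.finrank ℂ A = n + 1 ∧ AdditiveActions.CorrespondsTo A α ∧
            IsLocalRing.maximalIdeal A ^ 2 = ⊥) ∧
        ∀ (A : Type u) [CommRing A] [Algebra ℂ A] [IsLocalRing A] [FiniteDimensional ℂ A],
          Module.finrank ℂ A = n + 1 → AdditiveActions.CorrespondsTo A α →
            IsLocalRing.maximalIdeal A ^ 2 = ⊥) ∧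
    AdditiveActions.IsAdditiveAction (AdditiveActions.translationAction n) ∧
    AdditiveActions.OPCondition (AdditiveActions.translationAction n) := by
  refine ⟨fun α hα hOP => ?_, AdditiveActions.isAdditiveAction_translationAction n,
    AdditiveActions.opCondition_translationAction hn⟩
  obtain ⟨A, _, _, _, _, hfin, ε, e, he⟩ := hα.exists_localAlgebra hn
  have hcorr : AdditiveActions.CorrespondsTo A α := by
    refine ⟨ε, e, AdditiveActions.equivalent_of_linearEquiv (LinearEquiv.refl ℂ _) fun s x => ?_⟩
    have hid : ∀ p, AdditiveActions.projEquiv (LinearEquiv.refl ℂ (Fin (n + 1) → ℂ)) p = p :=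
      fun p => congrFun Projectivization.map_id p
    rw [hid, hid, he]
  have hsq := AdditiveActions.maximalIdeal_sq_eq_bot_of_opCondition hOP hcorr
  refine ⟨?_, ⟨A, _, _, _, _, hfin, hcorr, hsq⟩, fun B _ _ _ _ _ hB =>
    AdditiveActions.maximalIdeal_sq_eq_bot_of_opCondition hOP hB⟩
  rw [he]
  exact AdditiveActions.equivalent_translationAction_of_sq_eq_bot ε e hsq
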